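/- **Setting.** Let $n\in\{2,3\}$ and let $\Omega\subset\mathbb{R}^n$ be bounded and open. Let $a_{ij}=a_{ji}\in C^{0,1}(\overline\Omega)$ $(1\le i,j\le n)$ satisfy $\sum_{i,j}a_{ij}(x)\xi_i\xi_j\ge\alpha|\xi|^2$ for all $x\in\Omega$, $\xi\in\mathbb{R}^n$ and some $\alpha>0$, and let $a_0\in L^\infty(\Omega)$ with $a_0\ge 0$ a.e. For $z,v\in H^1_0(\Omega)$ (the closure of $C_c^\infty(\Omega)$ in $H^1(\Omega)$) put $$a(z,v)=\sum_{i,j=1}^n\int_\Omega a_{ij}\,\partial_{x_i}z\,\partial_{x_j}v\,\mathrm dx+\int_\Omega a_0\,z\,v\,\mathrm dx .$$ Let $\Gamma\subset\Omega$ be a $C^2$-hypersurface in $\mathbb{R}^n$ (near each of its points, $\Gamma$ is the zero set of a $C^2$ function whose gradient does not vanish on $\Gamma$), and suppose that $\Gamma\subset\partial U$ for some open set $U\subset\Omega$ with Lipschitz boundary. Let $L^2(\Gamma)$ be taken with respect to the surface measure ($(n-1)$-dimensional Hausdorff measure). Let $g_\Gamma\in L^2(\Gamma)$, $\nu>0$,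 and let $a,b\in\mathbb{R}$ with $a<b$, or $a=-\infty$ and $b=+\infty$. **Theorem 3.1.** There is exactly one operator $S:L^2(\Omega)\to H^1_0(\Omega)$ such that $a(S\eta,v)=(\eta,v)_{L^2(\Omega)}$ for all $\eta\in L^2(\Omega)$, $v\in H^1_0(\Omega)$, and exactly one continuous linear operator $T:H^1_0(\Omega)\to L^2(\Gamma)$ such that $Ty=y|_\Gamma$ for all $y\in H^1_0(\Omega)\cap C(\Omega)$. With these operators, the problem of minimising $$\hat J(\eta)=\tfrac12\|TS\eta-g_\Gamma\|_{L^2(\Gamma)}^2+\tfrac{\nu}{2}\|\eta\|_{L^2(\Omega)}^2$$ over $$U_{ad}=\{\eta\in L^2(\Omega): a\le\eta\le b \text{ a.e. in }\Omega\}$$ has a unique solution $u\in U_{ad}$, i.e. there is exactly one $u\in U_{ad}$ with $\hat J(u)\le\hat J(\eta)$ for all $\eta\in U_{ad}$. -/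

import Mathlib

open MeasureTheory TopologicalSpace
open scoped Distributions ENNReal ContDiff

namespace LineControl

/-- `ℝⁿ` with the Euclidean norm. -/
abbrev E (n : ℕ) : Type := EuclideanSpace ℝ (Fin n)

noncomputable section

/-! ### The Sobolev spaces `H¹(Ω)` and `H¹₀(Ω)` -/

/-- The real Hilbert space `L²(Ω)` (Lebesgue measure). -/
abbrev L2 {n : ℕ} (Ω : Opens (E n)) : Type :=
  Lp ℝ 2 ((volume : Measure (E n)).restrict (Ω : Set (E n)))

/-- The classical partial derivative `∂ᵢ φ (x)`. -/
def partialDeriv {n : ℕ} (i : Fin n) (φ : E n → ℝ) (x : E n) : ℝ :=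
  fderiv ℝ φ x (EuclideanSpace.single i 1)

/-- `w` is the weak partial derivative `∂ᵢ u` on `Ω`, for `u, w ∈ L²(Ω)`:
`∫_Ω u ∂ᵢφ = - ∫_Ω w φ` for all `φ ∈ C_c^∞(Ω)`. -/
def HasWeakPartialDeriv {n : ℕ} {Ω : Opens (E n)} (i : Fin n) (u w : L2 Ω) : Prop :=
  ∀ φ : 𝓓(Ω, ℝ),
    ∫ x in (Ω : Set (E n)), u x * partialDeriv i φ x = -∫ x in (Ω : Set (E n)), w x * φ x

/-- The Hilbert space `L²(Ω) × L²(Ω)ⁿ` of pairs `(u, (w₁, …, wₙ))`, with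
`‖(u, w)‖² = ‖u‖² + ∑ᵢ ‖wᵢ‖²`. -/
abbrev Jet {n : ℕ} (Ω : Opens (E n)) : Type :=
  WithLp 2 (L2 Ω × PiLp 2 (fun _ : Fin n => L2 Ω))

theorem integrable_mul_test {n : ℕ} {Ω : Opens (E n)} (u : L2 Ω) (φ : 𝓓(Ω, ℝ)) :
    Integrable (fun x => u x * φ x) ((volume : Measure (E n)).restrict (Ω : Set (E n))) :=
  (Lp.memLp u).integrable_mul
    (φ.continuous.memLp_of_hasCompactSupport (p := 2) φ.hasCompactSupport)

theorem integrable_mul_partialDeriv {n : ℕ} {Ω : Opens (E n)} (u : L2 Ω) (i : Fin n)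
    (φ : 𝓓(Ω, ℝ)) :
    Integrable (fun x => u x * partialDeriv i φ x)
      ((volume : Measure (E n)).restrict (Ω : Set (E n))) := by
  have hc : Continuous (partialDeriv i (φ : E n → ℝ)) :=
    (φ.contDiff.continuous_fderiv (by simp)).clm_apply continuous_const
  have hs : HasCompactSupport (partialDeriv i (φ : E n → ℝ)) :=
    φ.hasCompactSupport.fderiv_apply ℝ _
  exact (Lp.memLp u).integrable_mul (hc.memLp_of_hasCompactSupport (p := 2) hs)

theorem HasWeakPartialDeriv.zero {n : ℕ} {Ω : Opens (E n)} (i : Fin n) :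
    HasWeakPartialDeriv i (0 : L2 Ω) 0 := by
  intro φ
  have h := Lp.coeFn_zero ℝ 2 ((volume : Measure (E n)).restrict (Ω : Set (E n)))
  have h1 : ∫ x in (Ω : Set (E n)), (0 : L2 Ω) x * partialDeriv i φ x = 0 :=
    integral_eq_zero_of_ae (by filter_upwards [h] with x hx; rw [hx]; simp)
  have h2 : ∫ x in (Ω : Set (E n)), (0 : L2 Ω) x * φ x = 0 :=
    integral_eq_zero_of_ae (by filter_upwards [h] with x hx; rw [hx]; simp)
  rw [h1, h2, neg_zero]

theorem HasWeakPartialDeriv.add {n : ℕ} {Ω : Opens (E n)} {i : Fin n} {u w u' w' : L2 Ω}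
    (h : HasWeakPartialDeriv i u w) (h' : HasWeakPartialDeriv i u' w') :
    HasWeakPartialDeriv i (u + u') (w + w') := by
  intro φ
  have h1 : ∫ x in (Ω : Set (E n)), (u + u') x * partialDeriv i φ x =
      (∫ x in (Ω : Set (E n)), u x * partialDeriv i φ x) +
        ∫ x in (Ω : Set (E n)), u' x * partialDeriv i φ x := by
    rw [← integral_add (integrable_mul_partialDeriv u i φ) (integrable_mul_partialDeriv u' i φ)]
    refine integral_congr_ae ?_
    filter_upwards [Lp.coeFn_add u u'] with x hx
    rw [hx, Pi.add_apply, add_mul]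
  have h2 : ∫ x in (Ω : Set (E n)), (w + w') x * φ x =
      (∫ x in (Ω : Set (E n)), w x * φ x) + ∫ x in (Ω : Set (E n)), w' x * φ x := by
    rw [← integral_add (integrable_mul_test w φ) (integrable_mul_test w' φ)]
    refine integral_congr_ae ?_
    filter_upwards [Lp.coeFn_add w w'] with x hx
    rw [hx, Pi.add_apply, add_mul]
  rw [h1, h2, h φ, h' φ]
  ring

theorem HasWeakPartialDeriv.smul {n : ℕ} {Ω : Opens (E n)} {i : Fin n} {u w : L2 Ω}
    (c : ℝ) (h : HasWeakPartialDeriv i u w) : HasWeakPartialDeriv i (c • u) (c • w) := by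
  intro φ
  have h1 : ∫ x in (Ω : Set (E n)), (c • u) x * partialDeriv i φ x =
      c * ∫ x in (Ω : Set (E n)), u x * partialDeriv i φ x := by
    rw [← integral_const_mul]
    refine integral_congr_ae ?_
    filter_upwards [Lp.coeFn_smul c u] with x hx
    rw [hx, Pi.smul_apply, smul_eq_mul, mul_assoc]
  have h2 : ∫ x in (Ω : Set (E n)), (c • w) x * φ x =
      c * ∫ x in (Ω : Set (E n)), w x * φ x := by
    rw [← integral_const_mul]
    refine integral_congr_ae ?_
    filter_upwards [Lp.coeFn_smul c w] with x hx
    rw [hx, Pi.smul_apply, smul_eq_mul, mul_assoc]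
  rw [h1, h2, h φ]
  ring

/-- `H¹(Ω)`: a function `u ∈ L²(Ω)` together with its (unique) weak gradient in `L²(Ω)ⁿ`.
The inherited norm is `‖u‖² + ∑ᵢ ‖∂ᵢu‖²`. -/
def H1 {n : ℕ} (Ω : Opens (E n)) : Submodule ℝ (Jet Ω) where
  carrier := {z | ∀ i, HasWeakPartialDeriv i z.fst (z.snd i)}
  zero_mem' i := HasWeakPartialDeriv.zero i
  add_mem' h h' i := (h i).add (h' i)
  smul_mem' c _ h i := (h i).smul c

/-- `C_c^∞(Ω)` as a subspace of `H¹(Ω)`. -/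
def testSubmodule {n : ℕ} (Ω : Opens (E n)) : Submodule ℝ (Jet Ω) where
  carrier := {z | z ∈ H1 Ω ∧
    ∃ φ : 𝓓(Ω, ℝ), z.fst =ᵐ[(volume : Measure (E n)).restrict (Ω : Set (E n))] φ}
  zero_mem' := ⟨(H1 Ω).zero_mem, 0, Lp.coeFn_zero ℝ 2 _⟩
  add_mem' := by
    rintro z z' ⟨hz, φ, hφ⟩ ⟨hz', φ', hφ'⟩
    refine ⟨(H1 Ω).add_mem hz hz', φ + φ', ?_⟩
    filter_upwards [Lp.coeFn_add z.fst z'.fst, hφ, hφ'] with x hx h1 h2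
    simpa [h1, h2] using hx
  smul_mem' := by
    rintro c z ⟨hz, φ, hφ⟩
    refine ⟨(H1 Ω).smul_mem c hz, c • φ, ?_⟩
    filter_upwards [Lp.coeFn_smul c z.fst, hφ] with x hx h1
    simpa [h1] using hx

/-- `H¹₀(Ω)`: the closure of `C_c^∞(Ω)` in `H¹(Ω)`. -/
def H10 {n : ℕ} (Ω : Opens (E n)) : Submodule ℝ (Jet Ω) :=
  H1 Ω ⊓ (testSubmodule Ω).topologicalClosure

/-- The element of `L²(Ω)` underlying `y ∈ H¹₀(Ω)`. -/
def H10.val {n : ℕ} {Ω : Opens (E n)} (y : H10 Ω) : L2 Ω := (y : Jet Ω).fst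

/-- The weak partial derivative `∂ᵢ y ∈ L²(Ω)` of `y ∈ H¹₀(Ω)`. -/
def H10.grad {n : ℕ} {Ω : Opens (E n)} (y : H10 Ω) (i : Fin n) : L2 Ω := (y : Jet Ω).snd i

/-! ### The state equation -/

/-- The bilinear form of `A z = -∑ ∂ⱼ(aᵢⱼ ∂ᵢ z) + a₀ z`. -/
def bilin {n : ℕ} {Ω : Opens (E n)} (a : Fin n → Fin n → E n → ℝ) (a₀ : E n → ℝ)
    (z v : H10 Ω) : ℝ :=
  (∑ i, ∑ j, ∫ x in (Ω : Set (E n)), a i j x * H10.grad z i x * H10.grad v j x) +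
    ∫ x in (Ω : Set (E n)), a₀ x * H10.val z x * H10.val v x

/-- `S : L²(Ω) → H¹₀(Ω)` is the control-to-state operator: for every `η`, `y = S η` solves
`a(y, v) = (η, v)_{L²(Ω)}` for all `v ∈ H¹₀(Ω)`. -/
def IsControlToState {n : ℕ} {Ω : Opens (E n)} (a : Fin n → Fin n → E n → ℝ) (a₀ : E n → ℝ)
    (S : L2 Ω → H10 Ω) : Prop :=
  ∀ (η : L2 Ω) (v : H10 Ω), bilin a a₀ (S η) v = inner ℝ η (H10.val v)

/-! ### Hypersurfaces, surface measure and traces -/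

/-- `Γ` is a `C²`-hypersurface in `ℝⁿ`: near each of its points it is the zero set of a `C²`
function whose gradient does not vanish on `Γ`. -/
def IsC2Hypersurface {n : ℕ} (Γ : Set (E n)) : Prop :=
  ∀ x₀ ∈ Γ, ∃ (V : Set (E n)) (φ : E n → ℝ), IsOpen V ∧ x₀ ∈ V ∧ ContDiffOn ℝ 2 φ V ∧
    (∀ x ∈ V ∩ Γ, gradient φ x ≠ 0) ∧ V ∩ Γ = {x ∈ V | φ x = 0}

/-- The boundary of `U` is Lipschitz: near each boundary point there are Cartesian coordinates
`(y', yₙ) ∈ ℝⁿ⁻¹ × ℝ` (given by a rigid motion `e`) and a Lipschitz function `ψ` such that `U` is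
`{yₙ < ψ(y')}` and `∂U` is `{yₙ = ψ(y')}`. -/
def HasLipschitzBoundary {n : ℕ} (U : Set (E n)) : Prop :=
  ∀ x₀ ∈ frontier U, ∃ (V : Set (E n)) (e : E n ≃ᵃⁱ[ℝ] WithLp 2 (E (n - 1) × ℝ))
    (ψ : E (n - 1) → ℝ), IsOpen V ∧ x₀ ∈ V ∧ (∃ K, LipschitzWith K ψ) ∧
      V ∩ U = {x ∈ V | (e x).snd < ψ (e x).fst} ∧
      V ∩ frontier U = {x ∈ V | (e x).snd = ψ (e x).fst}

/-- The surface measure `dA` on `Γ`: the `(n-1)`-dimensional Hausdorff measure (normalised as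
Euclidean surface area) restricted to `Γ`. -/
def surfaceMeasure {n : ℕ} (Γ : Set (E n)) : Measure (E n) :=
  (Measure.euclideanHausdorffMeasure (n - 1)).restrict Γ

/-- The real Hilbert space `L²(Γ)`. -/
abbrev L2Surface {n : ℕ} (Γ : Set (E n)) : Type := Lp ℝ 2 (surfaceMeasure Γ)

/-- The continuous linear operator `T : H¹₀(Ω) → L²(Γ)` satisfies `T y = y|_Γ` for all
`y ∈ H¹₀(Ω) ∩ C(Ω)`. Here `f` is the continuous representative of `y`. -/
def IsTrace {n : ℕ} {Ω : Opens (E n)} {Γ : Set (E n)} (T : H10 Ω →L[ℝ] L2Surface Γ) : Prop :=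
  ∀ (y : H10 Ω) (f : E n → ℝ), ContinuousOn f (Ω : Set (E n)) →
    H10.val y =ᵐ[(volume : Measure (E n)).restrict (Ω : Set (E n))] f →
      T y =ᵐ[surfaceMeasure Γ] f

/-! ### The optimal control problem -/

/-- The admissible set `{η ∈ L²(Ω) : lo ≤ η ≤ hi a.e. in Ω}`. -/
def admissible {n : ℕ} (Ω : Opens (E n)) (lo hi : EReal) : Set (L2 Ω) :=
  {η | ∀ᵐ x ∂(volume : Measure (E n)).restrict (Ω : Set (E n)),
    lo ≤ ((η x : ℝ) : EReal) ∧ ((η x : ℝ) : EReal) ≤ hi}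

/-- `J(y, η) = ½ ‖y|_Γ - g‖²_{L²(Γ)} + (ν/2) ‖η‖²_{L²(Ω)}`, with `y|_Γ = T y`. -/
def cost {n : ℕ} {Ω : Opens (E n)} {Γ : Set (E n)} (T : H10 Ω →L[ℝ] L2Surface Γ)
    (g : L2Surface Γ) (ν : ℝ) (y : H10 Ω) (η : L2 Ω) : ℝ :=
  1 / 2 * ‖T y - g‖ ^ 2 + ν / 2 * ‖η‖ ^ 2

/-- The reduced functional `Ĵ(η) = J(S η, η)`. -/
def reducedCost {n : ℕ} {Ω : Opens (E n)} {Γ : Set (E n)} (S : L2 Ω → H10 Ω)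
    (T : H10 Ω →L[ℝ] L2Surface Γ) (g : L2Surface Γ) (ν : ℝ) (η : L2 Ω) : ℝ :=
  cost T g ν (S η) η

end

end LineControl

open LineControl

/-!
The three assertions rest on the Hilbert space structure of `H¹₀(Ω)`, which is complete because the
weak derivative relation is closed in `L²`.

*The state equation.* A translation of length larger than the diameter of `Ω` moves `Ω` off itself,
so a test function is the integral of its derivative along a segment leaving `Ω`. This gives the
Poincaré inequality (`poincare_H10`), hence coercivity of the bilinear form, and Lax–Milgram yields
the operator `S`, which is linear and bounded (`exists_controlToState`).

*The trace.* The only property of the surface that matters is expressed by `IsTransversal μ v C`: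
smearing the measure `μ` along the direction `v` produces a measure bounded by `C` times Lebesgue
measure. The surface measure of a bounded piece of a Lipschitz graph is finite and transversal to
the vertical direction, and the compact boundary of `U` is covered by finitely many such pieces
(`exists_transversal_cover`). For a transversal measure and a test function `φ`,
`∫ |φ(x + t v) - φ(x)|² dμ ≤ t C ∫ |∂ᵥφ|²`; averaging over `t ∈ (0, 1]` bounds the restriction of
`φ` in `L²(μ)` by its `H¹` norm, so that restriction extends from test functions to `H¹₀(Ω)`. By
density the same estimate shows that the translates `y(· + δ² s v)`, `s ∈ (0, 1]`, of any
`y ∈ H¹₀(Ω)` converge to its trace in `L²(μ × ds)` as `δ → 0`. If `y` has a continuous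
representative `f`, they also converge pointwise to `f`, so Fatou's lemma identifies the trace of
`y` with `f` (`IsTransversal.trace_ae_eq`).

*The control problem.* Up to a factor `1/2`, the reduced functional is the squared distance between
`(g, 0)` and `(T S η, √ν η)` in a product Hilbert space; the admissible controls give a closed
convex set of such pairs, and the projection onto it is the minimiser (`existsUnique_tikhonov`).
-/

namespace LineControl

open Set Filter Topology

/-! ### Difference quotients along a direction -/

/-- Cauchy–Schwarz against the constant `1` on `(0, t]`. -/
theorem sq_lintegral_Ioc_le {f : ℝ → ℝ≥0∞} (hf : AEMeasurable f) (t : ℝ) :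
    (∫⁻ s in Ioc 0 t, f s) ^ 2 ≤ ENNReal.ofReal t * ∫⁻ s in Ioc 0 t, f s ^ 2 := by
  have h := ENNReal.lintegral_mul_le_Lp_mul_Lq (volume.restrict (Ioc 0 t))
    Real.HolderConjugate.two_two hf.restrict (aemeasurable_const (b := (1 : ℝ≥0∞)))
  simp only [Pi.mul_apply, mul_one, lintegral_const,
    Measure.restrict_apply MeasurableSet.univ, univ_inter, Real.volume_Ioc, sub_zero,
    ENNReal.rpow_two] at h
  calc _ ≤ _ := pow_le_pow_left' h 2
    _ = _ := by
      rw [mul_pow, ← ENNReal.rpow_two, ← ENNReal.rpow_two, ← ENNReal.rpow_mul, ← ENNReal.rpow_mul]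
      simp [mul_comm]

/-- The fundamental theorem of calculus along the segment from `x` to `x + t v`, combined with
Cauchy–Schwarz. -/
theorem enorm_sub_sq_le {n : ℕ} {φ : E n → ℝ} (hφ : ContDiff ℝ 1 φ) (x v : E n) {t : ℝ}
    (ht : 0 ≤ t) :
    ‖φ (x + t • v) - φ x‖ₑ ^ 2 ≤
      ENNReal.ofReal t * ∫⁻ s in Ioc 0 t, ‖fderiv ℝ φ (x + s • v) v‖ₑ ^ 2 := by
  have hc : Continuous fun s : ℝ => fderiv ℝ φ (x + s • v) v :=
    ((hφ.continuous_fderiv (by simp)).comp (by fun_prop)).clm_apply continuous_const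
  have hd : ∀ s : ℝ, HasDerivAt (fun s : ℝ => φ (x + s • v)) (fderiv ℝ φ (x + s • v) v) s := by
    intro s
    have h1 : HasDerivAt (fun s : ℝ => x + s • v) v s := by
      simpa using ((hasDerivAt_id s).smul_const v).const_add x
    exact ((hφ.differentiable (by simp)) _).hasFDerivAt.comp_hasDerivAt s h1
  have hint := intervalIntegral.integral_eq_sub_of_hasDerivAt (a := 0) (b := t)
    (fun s _ => hd s) (hc.intervalIntegrable _ _)
  simp only [zero_smul, add_zero] at hint
  rw [← hint, intervalIntegral.integral_of_le ht]
  refine (pow_le_pow_left' (enorm_integral_le_lintegral_enorm _) 2).trans ?_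
  exact sq_lintegral_Ioc_le hc.measurable.enorm.aemeasurable t

/-- A measure `μ` is transversal to the direction `v` with constant `C` if Lebesgue measure,
up to the factor `C`, dominates the image of `μ × dt` under `(x, t) ↦ x + t v`. -/
def IsTransversal {n : ℕ} (μ : Measure (E n)) (v : E n) (C : ℝ≥0∞) : Prop :=
  ∀ F : E n → ℝ≥0∞, Measurable F → ∫⁻ x, (∫⁻ t : ℝ, F (x + t • v)) ∂μ ≤ C * ∫⁻ x, F x

theorem IsTransversal.mono {n : ℕ} {μ μ' : Measure (E n)} {v : E n} {C : ℝ≥0∞}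
    (h : IsTransversal μ v C) (hle : μ' ≤ μ) : IsTransversal μ' v C :=
  fun F hF => (lintegral_mono' hle le_rfl).trans (h F hF)

/-- Continuity of translations of a `C¹` function in `L²(μ)`, with a modulus controlled by its
derivative in `L²` of the whole space. -/
theorem IsTransversal.lintegral_sub_sq_le {n : ℕ} {μ : Measure (E n)} {v : E n} {C : ℝ≥0∞}
    (h : IsTransversal μ v C) {φ : E n → ℝ} (hφ : ContDiff ℝ 1 φ) {t : ℝ} (ht : 0 ≤ t) :
    ∫⁻ x, ‖φ (x + t • v) - φ x‖ₑ ^ 2 ∂μ ≤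
      ENNReal.ofReal t * (C * ∫⁻ x, ‖fderiv ℝ φ x v‖ₑ ^ 2) := by
  have hm : Measurable fun x => ‖fderiv ℝ φ x v‖ₑ ^ 2 :=
    (((hφ.continuous_fderiv (by simp)).clm_apply continuous_const).measurable.enorm).pow_const 2
  calc ∫⁻ x, ‖φ (x + t • v) - φ x‖ₑ ^ 2 ∂μ
      ≤ ∫⁻ x, ENNReal.ofReal t * (∫⁻ s : ℝ, ‖fderiv ℝ φ (x + s • v) v‖ₑ ^ 2) ∂μ := by
        refine lintegral_mono fun x => (enorm_sub_sq_le hφ x v ht).trans ?_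
        gcongr
        exact Measure.restrict_le_self
    _ = ENNReal.ofReal t * ∫⁻ x, (∫⁻ s : ℝ, ‖fderiv ℝ φ (x + s • v) v‖ₑ ^ 2) ∂μ :=
        lintegral_const_mul' _ _ ENNReal.ofReal_ne_top
    _ ≤ _ := by gcongr; exact h _ hm

theorem enorm_sq_le_two_mul (a b : ℝ) : ‖a‖ₑ ^ 2 ≤ 2 * (‖b‖ₑ ^ 2 + ‖b - a‖ₑ ^ 2) := by
  have h : ‖a‖ₑ ≤ ‖b‖ₑ + ‖b - a‖ₑ := by
    simpa [enorm_sub_rev] using enorm_sub_le (a := b) (b := b - a)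
  refine (pow_le_pow_left' h 2).trans ?_
  have := ENNReal.rpow_add_le_mul_rpow_add_rpow ‖b‖ₑ ‖b - a‖ₑ (p := 2) (by norm_num)
  norm_num at this
  simpa using this

/-- The trace inequality for `C¹` functions. -/
theorem IsTransversal.lintegral_sq_le {n : ℕ} {μ : Measure (E n)} {v : E n} {C : ℝ≥0∞} [SFinite μ]
    (h : IsTransversal μ v C) {φ : E n → ℝ} (hφ : ContDiff ℝ 1 φ) :
    ∫⁻ x, ‖φ x‖ₑ ^ 2 ∂μ ≤
      2 * (C * (∫⁻ x, ‖φ x‖ₑ ^ 2) + C * ∫⁻ x, ‖fderiv ℝ φ x v‖ₑ ^ 2) := by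
  have hc := hφ.continuous
  have hm1 : Measurable fun p : ℝ × E n => ‖φ (p.2 + p.1 • v)‖ₑ ^ 2 := by
    have : Continuous fun p : ℝ × E n => φ (p.2 + p.1 • v) := by fun_prop
    exact this.measurable.enorm.pow_const 2
  have hm2 : Measurable fun p : ℝ × E n => ‖φ (p.2 + p.1 • v) - φ p.2‖ₑ ^ 2 := by
    have : Continuous fun p : ℝ × E n => φ (p.2 + p.1 • v) - φ p.2 := by fun_prop
    exact this.measurable.enorm.pow_const 2
  have hm3 (t : ℝ) : Measurable fun x : E n => ‖φ (x + t • v)‖ₑ ^ 2 := by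
    have : Continuous fun x : E n => φ (x + t • v) := by fun_prop
    exact this.measurable.enorm.pow_const 2
  have h1 : ∫⁻ t in Ioc (0 : ℝ) 1, ∫⁻ x, ‖φ (x + t • v)‖ₑ ^ 2 ∂μ ≤ C * ∫⁻ x, ‖φ x‖ₑ ^ 2 := by
    refine (setLIntegral_le_lintegral _ _).trans ?_
    rw [lintegral_lintegral_swap hm1.aemeasurable]
    exact h _ (hc.measurable.enorm.pow_const 2)
  have h2 : ∫⁻ t in Ioc (0 : ℝ) 1, ∫⁻ x, ‖φ (x + t • v) - φ x‖ₑ ^ 2 ∂μ ≤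
      C * ∫⁻ x, ‖fderiv ℝ φ x v‖ₑ ^ 2 := by
    calc _ ≤ ∫⁻ t in Ioc (0 : ℝ) 1, (C * ∫⁻ x, ‖fderiv ℝ φ x v‖ₑ ^ 2) := by
          refine setLIntegral_mono' measurableSet_Ioc fun t ht => ?_
          refine (h.lintegral_sub_sq_le hφ ht.1.le).trans ?_
          refine mul_le_of_le_one_left' ?_
          simpa using ENNReal.ofReal_le_ofReal ht.2
      _ = _ := by simp
  -- average the pointwise bound over `t ∈ (0, 1]`
  calc ∫⁻ x, ‖φ x‖ₑ ^ 2 ∂μ = ∫⁻ t in Ioc (0 : ℝ) 1, ∫⁻ x, ‖φ x‖ₑ ^ 2 ∂μ := by simp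
    _ ≤ ∫⁻ t in Ioc (0 : ℝ) 1, ∫⁻ x,
          2 * (‖φ (x + t • v)‖ₑ ^ 2 + ‖φ (x + t • v) - φ x‖ₑ ^ 2) ∂μ :=
        lintegral_mono fun t => lintegral_mono fun x => enorm_sq_le_two_mul _ _
    _ = ∫⁻ t in Ioc (0 : ℝ) 1, 2 * ((∫⁻ x, ‖φ (x + t • v)‖ₑ ^ 2 ∂μ) +
          ∫⁻ x, ‖φ (x + t • v) - φ x‖ₑ ^ 2 ∂μ) := by
        refine lintegral_congr fun t => ?_
        rw [lintegral_const_mul' _ _ (by simp), lintegral_add_left (hm3 t)]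
    _ = 2 * ((∫⁻ t in Ioc (0 : ℝ) 1, ∫⁻ x, ‖φ (x + t • v)‖ₑ ^ 2 ∂μ) +
          ∫⁻ t in Ioc (0 : ℝ) 1, ∫⁻ x, ‖φ (x + t • v) - φ x‖ₑ ^ 2 ∂μ) := by
        rw [lintegral_const_mul' _ _ (by simp), lintegral_add_left hm1.lintegral_prod_right']
    _ ≤ _ := mul_le_mul_right (add_le_add h1 h2) 2

/-- The Poincaré inequality for a function whose support is moved off itself by the translation
by `R v`. -/
theorem poincare_lintegral {n : ℕ} {φ : E n → ℝ} (hφ : ContDiff ℝ 1 φ) {v : E n} {R : ℝ}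
    (hR : 0 ≤ R) (hv : ∀ x, φ x ≠ 0 → φ (x + R • v) = 0) :
    ∫⁻ x, ‖φ x‖ₑ ^ 2 ≤ ENNReal.ofReal R * (ENNReal.ofReal R * ∫⁻ x, ‖fderiv ℝ φ x v‖ₑ ^ 2) := by
  have hcd : Continuous fun x => fderiv ℝ φ x v :=
    (hφ.continuous_fderiv (by simp)).clm_apply continuous_const
  have hm : Measurable fun p : E n × ℝ => ‖fderiv ℝ φ (p.1 + p.2 • v) v‖ₑ ^ 2 := by
    have : Continuous fun p : E n × ℝ => fderiv ℝ φ (p.1 + p.2 • v) v :=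
      hcd.comp (g := fun x => fderiv ℝ φ x v) (by fun_prop)
    exact this.measurable.enorm.pow_const 2
  calc ∫⁻ x, ‖φ x‖ₑ ^ 2
      ≤ ∫⁻ x, ENNReal.ofReal R * ∫⁻ s in Ioc 0 R, ‖fderiv ℝ φ (x + s • v) v‖ₑ ^ 2 := by
        refine lintegral_mono fun x => ?_
        by_cases hx : φ x = 0
        · simp [hx]
        · simpa [hv x hx] using enorm_sub_sq_le hφ x v hR
    _ = ENNReal.ofReal R * ∫⁻ s in Ioc 0 R, ∫⁻ x, ‖fderiv ℝ φ (x + s • v) v‖ₑ ^ 2 := by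
        rw [lintegral_const_mul' _ _ ENNReal.ofReal_ne_top,
          lintegral_lintegral_swap hm.aemeasurable]
    _ = _ := by
        congr 1
        -- the inner integral does not depend on `s`, by translation invariance
        simp_rw [lintegral_add_right_eq_self (fun x => ‖fderiv ℝ φ x v‖ₑ ^ 2)]
        simp [mul_comm]

/-! ### Surface measure on Lipschitz graphs -/

theorem measurePreserving_affineIsometryEquiv {V W : Type*} [NormedAddCommGroup V]
    [InnerProductSpace ℝ V] [FiniteDimensional ℝ V] [MeasurableSpace V] [BorelSpace V]
    [NormedAddCommGroup W] [InnerProductSpace ℝ W] [FiniteDimensional ℝ W] [MeasurableSpace W]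
    [BorelSpace W] (e : V ≃ᵃⁱ[ℝ] W) : MeasurePreserving e (volume : Measure V) volume := by
  have h := e.toIsometryEquiv.measurePreserving_euclideanHausdorffMeasure (Module.finrank ℝ V)
  have hf : Module.finrank ℝ V = Module.finrank ℝ W :=
    e.linearIsometryEquiv.toLinearEquiv.finrank_eq
  rw [InnerProductSpace.euclideanHausdorffMeasure_eq_volume, hf,
    InnerProductSpace.euclideanHausdorffMeasure_eq_volume] at h
  exact h

/-- The parametrisation `y ↦ e⁻¹(y, ψ y)` of a graph given in the Cartesian coordinates `e`. -/
noncomputable def graphParam {n m : ℕ} (e : E n ≃ᵃⁱ[ℝ] WithLp 2 (E m × ℝ)) (ψ : E m → ℝ) (y : E m) :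
    E n :=
  e.symm (WithLp.toLp 2 (y, ψ y))

/-- The unit vector of the vertical axis of the Cartesian coordinates `e`. -/
noncomputable def verticalDir {n m : ℕ} (e : E n ≃ᵃⁱ[ℝ] WithLp 2 (E m × ℝ)) : E n :=
  e.linearIsometryEquiv.symm (WithLp.toLp 2 (0, 1))

theorem graphParam_add_smul {n m : ℕ} (e : E n ≃ᵃⁱ[ℝ] WithLp 2 (E m × ℝ)) (ψ : E m → ℝ)
    (y : E m) (t : ℝ) :
    graphParam e ψ y + t • verticalDir e = e.symm (WithLp.toLp 2 (y, ψ y + t)) := by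
  have h := e.symm.map_vadd (WithLp.toLp 2 (y, ψ y)) (t • WithLp.toLp 2 ((0 : E m), (1 : ℝ)))
  have h2 : (WithLp.toLp 2 (y, ψ y + t) : WithLp 2 (E m × ℝ)) =
      t • WithLp.toLp 2 ((0 : E m), (1 : ℝ)) +ᵥ (WithLp.toLp 2 (y, ψ y) : WithLp 2 (E m × ℝ)) := by
    rw [vadd_eq_add, ← WithLp.toLp_smul, ← WithLp.toLp_add]
    simp [add_comm]
  rw [h2, h, graphParam, verticalDir, map_smul, vadd_eq_add, add_comm]
  rfl

theorem lipschitzWith_graphParam {n m : ℕ} (e : E n ≃ᵃⁱ[ℝ] WithLp 2 (E m × ℝ)) {ψ : E m → ℝ}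
    {K : NNReal} (hψ : LipschitzWith K ψ) : ∃ L, LipschitzWith L (graphParam e ψ) := by
  have h1 : LipschitzWith _ fun y : E m => (y, ψ y) := LipschitzWith.id.prodMk hψ
  exact ⟨_, e.symm.lipschitz.comp ((WithLp.prod_lipschitzWith_toLp 2 _ _).comp h1)⟩

/-- A Lipschitz parametrisation increases `m`-dimensional measure at most by the `m`-th power of
its Lipschitz constant. The normalisation factor of the surface measure cancels. -/
theorem euclideanHausdorffMeasure_image_le {n m : ℕ} {γ : E m → E n} {L : NNReal}
    (hγ : LipschitzWith L γ) (s : Set (E m)) :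
    Measure.euclideanHausdorffMeasure m (γ '' s) ≤ (L : ℝ≥0∞) ^ m * volume s := by
  have h := hγ.hausdorffMeasure_image_le (d := m) (by positivity) s
  rw [← EuclideanSpace.euclideanHausdorffMeasure_eq_volume]
  simp only [Measure.euclideanHausdorffMeasure_def, Measure.smul_apply]
  rw [ENNReal.rpow_natCast] at h
  rw [mul_smul_comm]
  gcongr

/-- Surface measure on a Lipschitz graph is dominated by Lebesgue measure on the base. -/
theorem euclideanHausdorffMeasure_restrict_le {n m : ℕ} {γ : E m → E n} {L : NNReal}
    (hγ : LipschitzWith L γ) {A : Set (E n)} (hA : A ⊆ range γ) :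
    (Measure.euclideanHausdorffMeasure m).restrict A ≤
      ((L : ℝ≥0∞) ^ m) • (volume : Measure (E m)).map γ := by
  refine Measure.le_iff.2 fun s hs => ?_
  rw [Measure.restrict_apply hs, Measure.smul_apply, Measure.map_apply hγ.continuous.measurable hs,
    smul_eq_mul]
  refine le_trans (measure_mono ?_) (euclideanHausdorffMeasure_image_le hγ _)
  rintro x ⟨hx, hxA⟩
  obtain ⟨y, rfl⟩ := hA hxA
  exact ⟨y, hx, rfl⟩

/-- Surface measure on a Lipschitz graph is transversal to the vertical direction. -/
theorem isTransversal_graph {n m : ℕ} (e : E n ≃ᵃⁱ[ℝ] WithLp 2 (E m × ℝ)) {ψ : E m → ℝ}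
    (hψ : Continuous ψ) {μ : Measure (E n)} {c : ℝ≥0∞}
    (hμ : μ ≤ c • (volume : Measure (E m)).map (graphParam e ψ)) :
    IsTransversal μ (verticalDir e) c := by
  intro F hF
  have hg : Measurable (graphParam e ψ) := by
    have : Continuous (graphParam e ψ) := by
      unfold graphParam
      exact e.symm.continuous.comp ((WithLp.prod_continuous_toLp 2 _ _).comp (by fun_prop))
    exact this.measurable
  have hm : Measurable fun p : E n × ℝ => F (p.1 + p.2 • verticalDir e) :=
    hF.comp (by fun_prop)
  have hmp : MeasurePreserving (fun p : E m × ℝ => e.symm (WithLp.toLp 2 p)) volume volume :=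
    (measurePreserving_affineIsometryEquiv e.symm).comp (WithLp.volume_preserving_toLp _ _)
  refine (lintegral_mono' hμ le_rfl).trans ?_
  rw [lintegral_smul_measure, lintegral_map hm.lintegral_prod_right' hg, smul_eq_mul]
  refine le_of_eq ?_
  congr 1
  calc ∫⁻ y, ∫⁻ t : ℝ, F (graphParam e ψ y + t • verticalDir e)
      = ∫⁻ y : E m, ∫⁻ t : ℝ, F (e.symm (WithLp.toLp 2 (y, t))) := by
        -- on each vertical line, the shear by `ψ y` is a translation
        refine lintegral_congr fun y => ?_
        simp_rw [graphParam_add_smul]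
        exact lintegral_add_left_eq_self (fun t => F (e.symm (WithLp.toLp 2 (y, t)))) (ψ y)
    _ = ∫⁻ p : E m × ℝ, F (e.symm (WithLp.toLp 2 p)) :=
        (lintegral_prod _ (hF.comp hmp.measurable).aemeasurable).symm
    _ = ∫⁻ x, F x := hmp.lintegral_comp hF

/-- Surface measure on a bounded, not necessarily measurable, part of a Lipschitz graph is finite
and transversal to the vertical direction. -/
theorem exists_isTransversal_graph {n m : ℕ} (e : E n ≃ᵃⁱ[ℝ] WithLp 2 (E m × ℝ)) {ψ : E m → ℝ}
    {K : NNReal} (hψ : LipschitzWith K ψ) {A : Set (E n)} (hA : A ⊆ {x | (e x).snd = ψ (e x).fst})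
    (hb : Bornology.IsBounded A) :
    ∃ c : NNReal, IsFiniteMeasure ((Measure.euclideanHausdorffMeasure m).restrict A) ∧
      IsTransversal ((Measure.euclideanHausdorffMeasure m).restrict A) (verticalDir e) c := by
  obtain ⟨L, hL⟩ := lipschitzWith_graphParam e hψ
  have hr : A ⊆ range (graphParam e ψ) := by
    intro x hx
    have hx' : (e x).snd = ψ (e x).fst := hA hx
    refine ⟨(e x).fst, ?_⟩
    rw [graphParam, ← hx']
    exact e.symm_apply_apply x
  have hle := euclideanHausdorffMeasure_restrict_le hL hr
  refine ⟨L ^ m, ⟨?_⟩, ?_⟩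
  · -- the base of a bounded piece of the graph is bounded
    have hbase : Bornology.IsBounded (graphParam e ψ ⁻¹' A) := by
      have h1 : Bornology.IsBounded (e '' A) := e.lipschitz.isBounded_image hb
      have h2 := (WithLp.prod_lipschitzWith_ofLp 2 (E m) ℝ).isBounded_image h1
      have h3 := (LipschitzWith.prod_fst (α := E m) (β := ℝ)).isBounded_image h2
      refine h3.subset ?_
      intro y hy
      refine ⟨(y, ψ y), ⟨_, ⟨_, hy, rfl⟩, ?_⟩, rfl⟩
      simp [graphParam]
    rw [Measure.restrict_apply_univ, ← image_preimage_eq_of_subset hr]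
    refine (euclideanHausdorffMeasure_image_le hL _).trans_lt ?_
    exact ENNReal.mul_lt_top (by finiteness) hbase.measure_lt_top
  · refine isTransversal_graph e hψ.continuous ?_
    simpa using hle

/-! ### Weak derivatives of test functions, and completeness of `H¹₀` -/

theorem lintegral_enorm_sq_eq_eLpNorm {α : Type*} [MeasurableSpace α] (μ : Measure α)
    (f : α → ℝ) : ∫⁻ x, ‖f x‖ₑ ^ 2 ∂μ = eLpNorm f 2 μ ^ 2 := by
  have h := eLpNorm_nnreal_pow_eq_lintegral (p := 2) (f := f) (μ := μ) (by norm_num)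
  simp only [NNReal.coe_ofNat, ENNReal.rpow_ofNat, ENNReal.coe_ofNat] at h
  exact h.symm

theorem lintegral_enorm_sq_eq {α : Type*} [MeasurableSpace α] {μ : Measure α} (u : Lp ℝ 2 μ) :
    ∫⁻ x, ‖u x‖ₑ ^ 2 ∂μ = ‖u‖ₑ ^ 2 := by
  rw [Lp.enorm_def, lintegral_enorm_sq_eq_eLpNorm]

theorem eLpNorm_two_le {α : Type*} [MeasurableSpace α] {μ : Measure α} {f : α → ℝ} {r : ℝ≥0∞}
    (h : ∫⁻ x, ‖f x‖ₑ ^ 2 ∂μ ≤ r ^ 2) : eLpNorm f 2 μ ≤ r := by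
  rw [lintegral_enorm_sq_eq_eLpNorm] at h
  exact (ENNReal.pow_le_pow_left_iff two_ne_zero).1 h

theorem test_eq_zero {n : ℕ} {Ω : Opens (E n)} (φ : 𝓓(Ω, ℝ)) {x : E n} (hx : x ∉ (Ω : Set (E n))) :
    φ x = 0 :=
  image_eq_zero_of_notMem_tsupport fun h => hx (φ.tsupport_subset h)

theorem fderiv_test_eq_zero {n : ℕ} {Ω : Opens (E n)} (φ : 𝓓(Ω, ℝ)) {x : E n}
    (hx : x ∉ (Ω : Set (E n))) : fderiv ℝ φ x = 0 :=
  image_eq_zero_of_notMem_tsupport fun h => hx (φ.tsupport_subset (tsupport_fderiv_subset ℝ h))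

theorem contDiff_one_test {n : ℕ} {Ω : Opens (E n)} (φ : 𝓓(Ω, ℝ)) : ContDiff ℝ 1 (φ : E n → ℝ) :=
  φ.contDiff.of_le (by simp)

theorem integral_test_mul_partialDeriv {n : ℕ} {Ω : Opens (E n)} (φ ψ : 𝓓(Ω, ℝ)) (i : Fin n) :
    ∫ x in (Ω : Set (E n)), φ x * partialDeriv i ψ x =
      -∫ x in (Ω : Set (E n)), partialDeriv i φ x * ψ x := by
  have hc (φ : 𝓓(Ω, ℝ)) : Continuous (partialDeriv i (φ : E n → ℝ)) :=
    (φ.contDiff.continuous_fderiv (by simp)).clm_apply continuous_const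
  have hs (φ : 𝓓(Ω, ℝ)) : HasCompactSupport (partialDeriv i (φ : E n → ℝ)) :=
    φ.hasCompactSupport.fderiv_apply ℝ _
  rw [setIntegral_eq_integral_of_forall_compl_eq_zero fun x hx => by simp [test_eq_zero φ hx],
    setIntegral_eq_integral_of_forall_compl_eq_zero fun x hx => by simp [test_eq_zero ψ hx]]
  refine integral_mul_fderiv_eq_neg_fderiv_mul_of_integrable ?_ ?_ ?_ ?_ ?_
  · exact ((hc φ).mul ψ.continuous).integrable_of_hasCompactSupport (hs φ).mul_right
  · exact (φ.continuous.mul (hc ψ)).integrable_of_hasCompactSupport φ.hasCompactSupport.mul_right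
  · exact (φ.continuous.mul ψ.continuous).integrable_of_hasCompactSupport
      φ.hasCompactSupport.mul_right
  · exact fun x _ => (contDiff_one_test φ).differentiable (by simp) x
  · exact fun x _ => (contDiff_one_test ψ).differentiable (by simp) x

/-- The weak partial derivative of a test function is the classical one. -/
theorem HasWeakPartialDeriv.ae_eq_of_test {n : ℕ} {Ω : Opens (E n)} {i : Fin n} {u w : L2 Ω}
    (h : HasWeakPartialDeriv i u w) {φ : 𝓓(Ω, ℝ)}
    (hu : u =ᵐ[(volume : Measure (E n)).restrict (Ω : Set (E n))] φ) :
    w =ᵐ[(volume : Measure (E n)).restrict (Ω : Set (E n))] partialDeriv i φ := by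
  have hc : Continuous (partialDeriv i (φ : E n → ℝ)) :=
    (φ.contDiff.continuous_fderiv (by simp)).clm_apply continuous_const
  have hloc : LocallyIntegrableOn (fun x => w x - partialDeriv i φ x) (Ω : Set (E n)) volume :=
    locallyIntegrableOn_of_locallyIntegrable_restrict
      (((Lp.memLp w).locallyIntegrable (by norm_num)).sub hc.locallyIntegrable)
  have key := Ω.isOpen.ae_eq_zero_of_integral_contDiff_smul_eq_zero hloc ?_
  · rw [EventuallyEq, ae_restrict_iff' Ω.isOpen.measurableSet]
    filter_upwards [key] with x hx hxΩ
    exact sub_eq_zero.1 (hx hxΩ)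
  intro g hg hgc hgs
  let ψ : 𝓓(Ω, ℝ) := ⟨g, hg, hgc, hgs⟩
  have h1 : ∫ x in (Ω : Set (E n)), u x * partialDeriv i ψ x =
      ∫ x in (Ω : Set (E n)), φ x * partialDeriv i ψ x :=
    integral_congr_ae (by filter_upwards [hu] with x hx; rw [hx])
  have h2 := h ψ
  rw [h1, integral_test_mul_partialDeriv, neg_inj] at h2
  have hi : Integrable (fun x => partialDeriv i φ x * ψ x)
      (volume.restrict (Ω : Set (E n))) :=
    ((hc.mul ψ.continuous).integrable_of_hasCompactSupport
      ψ.hasCompactSupport.mul_left).integrableOn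
  calc ∫ x, g x • (w x - partialDeriv i φ x)
      = ∫ x in (Ω : Set (E n)), ψ x * (w x - partialDeriv i φ x) :=
        (setIntegral_eq_integral_of_forall_compl_eq_zero fun x hx => by
          exact mul_eq_zero_of_left (test_eq_zero ψ hx) _).symm
    _ = ∫ x in (Ω : Set (E n)), (w x * ψ x - partialDeriv i φ x * ψ x) := by
        congr 1; ext x; ring
    _ = 0 := by rw [integral_sub (integrable_mul_test w ψ) hi, h2, sub_self]

/-- For a fixed test function the weak derivative identity equates two `L²` inner products, so it
passes to limits. -/
theorem isClosed_H1 {n : ℕ} (Ω : Opens (E n)) : IsClosed (H1 Ω : Set (Jet Ω)) := by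
  have hset : (H1 Ω : Set (Jet Ω)) =
      ⋂ (i : Fin n), ⋂ (φ : 𝓓(Ω, ℝ)), {z | ∫ x in (Ω : Set (E n)), z.fst x * partialDeriv i φ x =
        -∫ x in (Ω : Set (E n)), z.snd i x * φ x} := by
    ext z
    simp [H1, HasWeakPartialDeriv]
  rw [hset]
  refine isClosed_iInter fun i => isClosed_iInter fun φ => ?_
  have hc : Continuous (partialDeriv i (φ : E n → ℝ)) :=
    (φ.contDiff.continuous_fderiv (by simp)).clm_apply continuous_const
  have hs : HasCompactSupport (partialDeriv i (φ : E n → ℝ)) :=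
    φ.hasCompactSupport.fderiv_apply ℝ _
  have key (f : E n → ℝ) (hf : MemLp f 2 ((volume : Measure (E n)).restrict (Ω : Set (E n))))
      (u : L2 Ω) : ∫ x in (Ω : Set (E n)), u x * f x = inner ℝ (hf.toLp f) u := by
    rw [L2.inner_def]
    refine integral_congr_ae ?_
    filter_upwards [hf.coeFn_toLp] with x hx
    simp [hx]
  simp only [key _ (hc.memLp_of_hasCompactSupport hs),
    key _ (φ.continuous.memLp_of_hasCompactSupport φ.hasCompactSupport)]
  refine isClosed_eq ?_ ?_
  · exact continuous_const.inner (WithLp.prod_continuous_ofLp 2 _ _).fst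
  · exact (continuous_const.inner ((PiLp.continuous_apply 2 _ i).comp
      (WithLp.prod_continuous_ofLp 2 _ _).snd)).neg

theorem testSubmodule_le_H1 {n : ℕ} (Ω : Opens (E n)) : testSubmodule Ω ≤ H1 Ω := fun _ h => h.1

theorem testSubmodule_le_H10 {n : ℕ} (Ω : Opens (E n)) : testSubmodule Ω ≤ H10 Ω :=
  le_inf (testSubmodule_le_H1 Ω) (testSubmodule Ω).le_topologicalClosure

instance instCompleteSpaceH10 {n : ℕ} (Ω : Opens (E n)) : CompleteSpace (H10 Ω) :=
  ((isClosed_H1 Ω).inter (testSubmodule Ω).isClosed_topologicalClosure).completeSpace_coe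

/-- The inclusion of `C_c^∞(Ω)` into `H¹₀(Ω)`. -/
noncomputable def testInclusion {n : ℕ} (Ω : Opens (E n)) : testSubmodule Ω →ₗ[ℝ] H10 Ω :=
  Submodule.inclusion (testSubmodule_le_H10 Ω)

theorem denseRange_testInclusion {n : ℕ} (Ω : Opens (E n)) : DenseRange (testInclusion Ω) := by
  intro y
  rw [Metric.mem_closure_range_iff]
  intro ε hε
  obtain ⟨z, hz, hd⟩ := Metric.mem_closure_iff.1 y.2.2 ε hε
  exact ⟨⟨z, hz⟩, hd⟩

theorem enorm_sq_add {n : ℕ} {Ω : Opens (E n)} (z : Jet Ω) :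
    ‖z‖ₑ ^ 2 = ‖z.fst‖ₑ ^ 2 + ∑ i, ‖z.snd i‖ₑ ^ 2 := by
  have h : ‖z‖ ^ 2 = ‖z.fst‖ ^ 2 + ∑ i, ‖z.snd i‖ ^ 2 := by
    rw [WithLp.prod_norm_sq_eq_of_L2, PiLp.norm_sq_eq_of_L2]
  simp only [← ofReal_norm, ← ENNReal.ofReal_pow (norm_nonneg _)]
  rw [h, ENNReal.ofReal_add (by positivity) (by positivity),
    ENNReal.ofReal_sum_of_nonneg (fun _ _ => by positivity)]

theorem lintegral_test_sq {n : ℕ} {Ω : Opens (E n)} {u : L2 Ω} {φ : 𝓓(Ω, ℝ)}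
    (hu : u =ᵐ[(volume : Measure (E n)).restrict (Ω : Set (E n))] φ) :
    ∫⁻ x, ‖φ x‖ₑ ^ 2 = ‖u‖ₑ ^ 2 := by
  rw [← lintegral_enorm_sq_eq, ← setLIntegral_eq_of_support_subset (s := (Ω : Set (E n)))]
  · refine lintegral_congr_ae ?_
    filter_upwards [hu] with x hx
    rw [hx]
  · intro x hx
    by_contra h
    simp [test_eq_zero φ h] at hx

theorem fderiv_apply_eq_sum {n : ℕ} (φ : E n → ℝ) (x v : E n) :
    fderiv ℝ φ x v = ∑ i, v i * partialDeriv i φ x := by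
  have h : v = ∑ i, v i • EuclideanSpace.single i (1 : ℝ) := by
    simpa using ((EuclideanSpace.basisFun (Fin n) ℝ).sum_repr v).symm
  conv_lhs => rw [h]
  simp [partialDeriv]

/-- A directional derivative of a test function, over the whole space, is bounded by the weak
gradient over `Ω`. -/
theorem lintegral_fderiv_test_sq_le {n : ℕ} {Ω : Opens (E n)} {z : Jet Ω} (hz : z ∈ H1 Ω)
    {φ : 𝓓(Ω, ℝ)} (hu : z.fst =ᵐ[(volume : Measure (E n)).restrict (Ω : Set (E n))] φ) (v : E n) :
    ∫⁻ x, ‖fderiv ℝ φ x v‖ₑ ^ 2 ≤ ‖v‖ₑ ^ 2 * ∑ i, ‖z.snd i‖ₑ ^ 2 := by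
  have hc (i) : Continuous (partialDeriv i (φ : E n → ℝ)) :=
    (φ.contDiff.continuous_fderiv (by simp)).clm_apply continuous_const
  have hz' (i) : ∫⁻ x, ‖partialDeriv i φ x‖ₑ ^ 2 = ‖z.snd i‖ₑ ^ 2 := by
    rw [← lintegral_enorm_sq_eq, ← setLIntegral_eq_of_support_subset (s := (Ω : Set (E n)))]
    · refine lintegral_congr_ae ?_
      filter_upwards [(hz i).ae_eq_of_test hu] with x hx
      rw [hx]
    · intro x hx
      by_contra h
      simp [partialDeriv, fderiv_test_eq_zero φ h] at hx
  have hp (x : E n) : ‖fderiv ℝ φ x v‖ₑ ^ 2 ≤ ‖v‖ₑ ^ 2 * ∑ i, ‖partialDeriv i φ x‖ₑ ^ 2 := by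
    have h : ‖fderiv ℝ φ x v‖ ^ 2 ≤ ‖v‖ ^ 2 * ∑ i, ‖partialDeriv i φ x‖ ^ 2 := by
      rw [fderiv_apply_eq_sum, EuclideanSpace.norm_sq_eq]
      simpa using Finset.sum_mul_sq_le_sq_mul_sq Finset.univ v.ofLp (fun i => partialDeriv i φ x)
    have h' := ENNReal.ofReal_le_ofReal h
    rwa [ENNReal.ofReal_mul (by positivity), ENNReal.ofReal_sum_of_nonneg
      (fun _ _ => by positivity), ENNReal.ofReal_pow (norm_nonneg _),
      ENNReal.ofReal_pow (norm_nonneg _), ofReal_norm, ofReal_norm,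
      Finset.sum_congr rfl fun i _ => by
        rw [ENNReal.ofReal_pow (norm_nonneg _), ofReal_norm]] at h'
  refine (lintegral_mono hp).trans_eq ?_
  rw [lintegral_const_mul' _ _ (by finiteness),
    lintegral_finsetSum _ fun i _ => ((hc i).measurable.enorm.pow_const 2)]
  simp_rw [hz']

/-! ### The trace operator -/

/-- A subset of the boundary of a bounded set with Lipschitz boundary is covered by finitely many
pieces on which surface measure is finite and transversal to some direction. -/
theorem exists_transversal_cover {n : ℕ} {Γ U : Set (E n)}
    (hU : Bornology.IsBounded U) (hL : HasLipschitzBoundary U) (hΓ : Γ ⊆ frontier U) :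
    ∃ (t : Finset (frontier U)) (V : t → Set (E n)),
      (∀ᵐ x ∂surfaceMeasure Γ, x ∈ ⋃ i, V i) ∧
      ∀ i, ∃ (v : E n) (C : NNReal), IsFiniteMeasure ((surfaceMeasure Γ).restrict (V i)) ∧
        IsTransversal ((surfaceMeasure Γ).restrict (V i)) v C := by
  have hbd : Bornology.IsBounded (frontier U) := hU.closure.subset frontier_subset_closure
  -- each boundary point has a neighbourhood in which the boundary is a Lipschitz graph
  choose! V e ψ hVo hxV hψ _ hVf using hL
  have hcpt := Metric.isCompact_of_isClosed_isBounded isClosed_frontier hbd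
  obtain ⟨t, ht⟩ := hcpt.elim_nhds_subcover'
    (fun x _ => V x) (fun x hx => (hVo x hx).mem_nhds (hxV x hx))
  have hm (i : t) : MeasurableSet (V i.1) := (hVo _ i.1.2).measurableSet
  refine ⟨t, fun i => V i.1, ?_, fun i => ?_⟩
  · have hmu : MeasurableSet (⋃ i : t, V i.1) := MeasurableSet.iUnion hm
    refine (ae_restrict_iff hmu).2 ?_
    filter_upwards with x hx
    obtain ⟨i, hi, hxi⟩ := mem_iUnion₂.1 (ht (hΓ hx))
    exact mem_iUnion.2 ⟨⟨i, hi⟩, hxi⟩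
  · obtain ⟨K, hK⟩ := hψ _ i.1.2
    have hsub : V i.1 ∩ Γ ⊆ {x | (e i.1 i.1.2 x).snd = ψ i.1 (e i.1 i.1.2 x).fst} := by
      rintro x ⟨hx, hxΓ⟩
      have : x ∈ V i.1 ∩ frontier U := ⟨hx, hΓ hxΓ⟩
      rw [hVf _ i.1.2] at this
      exact this.2
    obtain ⟨c, hc⟩ := exists_isTransversal_graph (e i.1 i.1.2) hK hsub
      (hbd.subset (inter_subset_right.trans hΓ))
    rw [surfaceMeasure, Measure.restrict_restrict (hm i)]
    exact ⟨_, c, hc⟩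

/-- The trace inequality for test functions on a transversal measure. -/
theorem IsTransversal.lintegral_test_sq_le {n : ℕ} {Ω : Opens (E n)} {μ : Measure (E n)}
    [SFinite μ] {v : E n} {C : NNReal} (h : IsTransversal μ v C) {z : Jet Ω} (hz : z ∈ H1 Ω)
    {φ : 𝓓(Ω, ℝ)} (hφ : z.fst =ᵐ[(volume : Measure (E n)).restrict (Ω : Set (E n))] φ) :
    ∫⁻ x, ‖φ x‖ₑ ^ 2 ∂μ ≤ (2 * C * (1 + ‖v‖₊ ^ 2) : NNReal) * ‖z‖ₑ ^ 2 := by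
  have h1 : ‖z.fst‖ₑ ^ 2 ≤ ‖z‖ₑ ^ 2 := by rw [enorm_sq_add z]; exact le_self_add
  have h2 : ∑ i, ‖z.snd i‖ₑ ^ 2 ≤ ‖z‖ₑ ^ 2 := by rw [enorm_sq_add z]; exact le_add_self
  calc ∫⁻ x, ‖φ x‖ₑ ^ 2 ∂μ
      ≤ 2 * (C * (∫⁻ x, ‖φ x‖ₑ ^ 2) + C * ∫⁻ x, ‖fderiv ℝ φ x v‖ₑ ^ 2) :=
        h.lintegral_sq_le (contDiff_one_test φ)
    _ ≤ 2 * (C * ‖z‖ₑ ^ 2 + C * (‖v‖ₑ ^ 2 * ‖z‖ₑ ^ 2)) := by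
        gcongr
        · exact (lintegral_test_sq hφ).trans_le h1
        · exact (lintegral_fderiv_test_sq_le hz hφ v).trans (by gcongr)
    _ = _ := by push_cast; rw [← enorm_eq_nnnorm]; ring

/-- A test function is determined by its class in `L²(Ω)`, also at the points of null sets such
as `Γ`. -/
theorem test_unique {n : ℕ} {Ω : Opens (E n)} {u : L2 Ω} {φ φ' : 𝓓(Ω, ℝ)}
    (h : u =ᵐ[(volume : Measure (E n)).restrict (Ω : Set (E n))] φ)
    (h' : u =ᵐ[(volume : Measure (E n)).restrict (Ω : Set (E n))] φ') : φ = φ' := by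
  have key := Measure.eqOn_open_of_ae_eq (h.symm.trans h') Ω.isOpen φ.continuous.continuousOn
    φ'.continuous.continuousOn
  ext x
  by_cases hx : x ∈ (Ω : Set (E n))
  · exact key hx
  · rw [test_eq_zero φ hx, test_eq_zero φ' hx]

/-- The test function underlying an element of `testSubmodule Ω`. -/
noncomputable def testRepr {n : ℕ} {Ω : Opens (E n)} : testSubmodule Ω →ₗ[ℝ] 𝓓(Ω, ℝ) where
  toFun z := z.2.2.choose
  map_add' z z' := by
    refine test_unique (z + z').2.2.choose_spec ?_
    filter_upwards [Lp.coeFn_add (z : Jet Ω).fst (z' : Jet Ω).fst, z.2.2.choose_spec,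
      z'.2.2.choose_spec] with x hx h1 h2
    simpa [h1, h2] using hx
  map_smul' c z := by
    refine test_unique (c • z).2.2.choose_spec ?_
    filter_upwards [Lp.coeFn_smul c (z : Jet Ω).fst, z.2.2.choose_spec] with x hx h1
    simpa [h1] using hx

theorem testRepr_spec {n : ℕ} {Ω : Opens (E n)} (z : testSubmodule Ω) :
    (z : Jet Ω).fst =ᵐ[(volume : Measure (E n)).restrict (Ω : Set (E n))] testRepr z :=
  z.2.2.choose_spec

/-- If restriction to the measure `σ` is bounded in the `H¹` norm on test functions, it extends to
`H¹₀(Ω)`. -/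
theorem exists_extension_of_test {n : ℕ} {Ω : Opens (E n)} {σ : Measure (E n)} {C : NNReal}
    (h : ∀ z : testSubmodule Ω, ∫⁻ x, ‖testRepr z x‖ₑ ^ 2 ∂σ ≤ C * ‖(z : Jet Ω)‖ₑ ^ 2) :
    ∃ T : H10 Ω →L[ℝ] Lp ℝ 2 σ, ∀ z : testSubmodule Ω,
      T (testInclusion Ω z) =ᵐ[σ] testRepr z := by
  have hmem (z : testSubmodule Ω) : MemLp (testRepr z) 2 σ := by
    refine ⟨(testRepr z).continuous.aestronglyMeasurable, ?_⟩
    have := (h z).trans_lt (by finiteness)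
    rw [lintegral_enorm_sq_eq_eLpNorm] at this
    simpa using this
  let T₀ : testSubmodule Ω →ₗ[ℝ] Lp ℝ 2 σ :=
    { toFun := fun z => (hmem z).toLp
      map_add' := fun z z' => by
        rw [← MemLp.toLp_add]
        refine MemLp.toLp_congr _ _ (Eventually.of_forall fun x => ?_)
        simp
      map_smul' := fun c z => by
        rw [RingHom.id_apply, ← MemLp.toLp_const_smul]
        refine MemLp.toLp_congr _ _ (Eventually.of_forall fun x => ?_)
        simp }
  have hT₀ (z) : T₀ z =ᵐ[σ] testRepr z := (hmem z).coeFn_toLp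
  have hb : ∃ c, ∀ z, ‖T₀ z‖ ≤ c * ‖testInclusion Ω z‖ := by
    refine ⟨NNReal.sqrt C, fun z => ?_⟩
    have h1 : ‖T₀ z‖ₑ ^ 2 ≤ (NNReal.sqrt C * ‖(z : Jet Ω)‖ₑ) ^ 2 := by
      rw [mul_pow, ← ENNReal.coe_pow, NNReal.sq_sqrt, ← lintegral_enorm_sq_eq]
      refine le_trans (le_of_eq ?_) (h z)
      refine lintegral_congr_ae ?_
      filter_upwards [hT₀ z] with x hx
      rw [hx]
    have h2 := (ENNReal.pow_le_pow_left_iff two_ne_zero).1 h1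
    rw [enorm_eq_nnnorm, enorm_eq_nnnorm, ← ENNReal.coe_mul, ENNReal.coe_le_coe] at h2
    exact NNReal.coe_le_coe.2 h2
  refine ⟨T₀.extendOfNorm (testInclusion Ω), fun z => ?_⟩
  rw [LinearMap.extendOfNorm_eq (denseRange_testInclusion Ω) hb]
  exact hT₀ z

/-- The trace operator, characterised by its values on test functions. -/
theorem exists_trace_on_test {n : ℕ} {Ω : Opens (E n)} {Γ U : Set (E n)}
    (hU : Bornology.IsBounded U) (hL : HasLipschitzBoundary U) (hΓ : Γ ⊆ frontier U) :
    ∃ T : H10 Ω →L[ℝ] L2Surface Γ, ∀ z : testSubmodule Ω,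
      T (testInclusion Ω z) =ᵐ[surfaceMeasure Γ] testRepr z := by
  obtain ⟨t, V, hcov, hV⟩ := exists_transversal_cover hU hL hΓ
  choose v C hfin htr using hV
  refine exists_extension_of_test (C := ∑ i, 2 * C i * (1 + ‖v i‖₊ ^ 2)) fun z => ?_
  rw [← Measure.restrict_eq_self_of_ae_mem hcov]
  refine (lintegral_iUnion_le _ _).trans ?_
  rw [tsum_fintype, ENNReal.ofNNReal_finsetSum, Finset.sum_mul]
  exact Finset.sum_le_sum fun i _ => (htr i).lintegral_test_sq_le z.2.1 (testRepr_spec z)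

/-! ### The trace of a function with a continuous representative -/

/-- The rescaled flow `(x, s) ↦ x + h s v`, for `s ∈ (0, 1]`. -/
def flow {n : ℕ} (v : E n) (h : ℝ) (p : E n × ℝ) : E n := p.1 + (h * p.2) • v

theorem continuous_flow {n : ℕ} (v : E n) (h : ℝ) : Continuous (flow v h) := by
  unfold flow; fun_prop

/-- Transversality for the flow at speed `h`: the change of variables `t = h s` costs a factor
`h⁻¹`. -/
theorem IsTransversal.map_flow_le {n : ℕ} {μ : Measure (E n)} [SFinite μ] {v : E n} {C : ℝ≥0∞}
    (ht : IsTransversal μ v C) {h : ℝ} (hh : 0 < h) :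
    (μ.prod (volume.restrict (Ioc 0 1))).map (flow v h) ≤ (ENNReal.ofReal h⁻¹ * C) • volume := by
  refine Measure.le_iff.2 fun s hs => ?_
  have hF : Measurable (s.indicator (1 : E n → ℝ≥0∞)) := measurable_one.indicator hs
  have hm := (continuous_flow v h).measurable
  rw [← lintegral_indicator_one hs, lintegral_map hF hm,
    lintegral_prod (fun p => s.indicator 1 (flow v h p)) (hF.comp hm).aemeasurable]
  calc _ ≤ ∫⁻ x, ENNReal.ofReal h⁻¹ * (∫⁻ t : ℝ, s.indicator 1 (x + t • v)) ∂μ := by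
        refine lintegral_mono fun x => (setLIntegral_le_lintegral _ _).trans_eq ?_
        have hG : Measurable fun t : ℝ => s.indicator (1 : E n → ℝ≥0∞) (x + t • v) :=
          hF.comp (by fun_prop)
        have := lintegral_map (μ := (volume : Measure ℝ)) hG (measurable_const_mul h)
        rw [Real.map_volume_mul_left hh.ne', lintegral_smul_measure, smul_eq_mul,
          abs_of_pos (inv_pos.2 hh)] at this
        exact this.symm
    _ ≤ _ := by
        rw [lintegral_const_mul' _ _ ENNReal.ofReal_ne_top, Measure.smul_apply, smul_eq_mul,
          mul_assoc]
        gcongr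
        refine (ht _ hF).trans_eq ?_
        rw [lintegral_indicator_one hs]

/-- Extension by zero of an element of `L²(Ω)`. -/
noncomputable def zeroExt {n : ℕ} {Ω : Opens (E n)} (u : L2 Ω) : E n → ℝ :=
  (Ω : Set (E n)).indicator u

theorem aestronglyMeasurable_zeroExt {n : ℕ} {Ω : Opens (E n)} (u : L2 Ω) :
    AEStronglyMeasurable (zeroExt u) volume :=
  (aestronglyMeasurable_indicator_iff Ω.isOpen.measurableSet).2 (Lp.aestronglyMeasurable u)

theorem zeroExt_ae_eq {n : ℕ} {Ω : Opens (E n)} {u : L2 Ω} {φ : 𝓓(Ω, ℝ)}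
    (hu : u =ᵐ[(volume : Measure (E n)).restrict (Ω : Set (E n))] φ) :
    zeroExt u =ᵐ[volume] φ := by
  filter_upwards [(ae_restrict_iff' Ω.isOpen.measurableSet).1 hu] with x hx
  by_cases h : x ∈ (Ω : Set (E n))
  · simp [zeroExt, h, hx h]
  · simp [zeroExt, h, test_eq_zero φ h]

theorem eLpNorm_zeroExt_sub {n : ℕ} {Ω : Opens (E n)} (u w : L2 Ω) :
    eLpNorm (zeroExt u - zeroExt w) 2 volume = ‖u - w‖ₑ := by
  have h : zeroExt u - zeroExt w = (Ω : Set (E n)).indicator (u - w : E n → ℝ) :=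
    (indicator_sub' _ _ _).symm
  rw [h, eLpNorm_indicator_eq_eLpNorm_restrict Ω.isOpen.measurableSet, Lp.enorm_def]
  exact eLpNorm_congr_ae (Lp.coeFn_sub u w).symm

theorem eLpNorm_comp_fst_sub_le {n : ℕ} {μ σ : Measure (E n)} (hle : μ ≤ σ)
    (u w : Lp ℝ 2 σ) :
    eLpNorm (fun p : E n × ℝ => u p.1 - w p.1) 2 (μ.prod (volume.restrict (Ioc 0 1))) ≤
      ‖u - w‖ₑ := by
  refine eLpNorm_two_le ?_
  have hm : AEMeasurable (fun x => ‖u x - w x‖ₑ ^ 2) μ :=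
    (((Lp.aestronglyMeasurable _).sub (Lp.aestronglyMeasurable _)).aemeasurable.enorm.pow_const
      2).mono_measure hle
  rw [lintegral_prod _ hm.comp_fst]
  simp only [lintegral_const, Measure.restrict_apply_univ, Real.volume_Ioc, sub_zero,
    ENNReal.ofReal_one, mul_one]
  refine (lintegral_mono' hle le_rfl).trans_eq ?_
  rw [← lintegral_enorm_sq_eq]
  refine lintegral_congr_ae ?_
  filter_upwards [Lp.coeFn_sub u w] with x hx
  rw [hx, Pi.sub_apply]

section

variable {n : ℕ} {Ω : Opens (E n)} {μ σ : Measure (E n)} [IsFiniteMeasure μ] {v : E n}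
  {C : NNReal}

theorem IsTransversal.quasiMeasurePreserving_flow (ht : IsTransversal μ v C) {h : ℝ} (hh : 0 < h) :
    Measure.QuasiMeasurePreserving (flow v h) (μ.prod (volume.restrict (Ioc 0 1))) volume :=
  ⟨(continuous_flow v h).measurable,
    (Measure.absolutelyContinuous_of_le (ht.map_flow_le hh)).trans
      Measure.smul_absolutelyContinuous⟩

/-- Composition with the flow at speed `δ²` is well defined and bounded on `L²`, with a norm that
grows like `δ⁻¹`. -/
theorem IsTransversal.eLpNorm_comp_flow_le (ht : IsTransversal μ v C) {δ : ℝ} (hδ : 0 < δ)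
    {f : E n → ℝ} (hf : AEStronglyMeasurable f volume) :
    eLpNorm (f ∘ flow v (δ ^ 2)) 2 (μ.prod (volume.restrict (Ioc 0 1))) ≤
      ENNReal.ofReal δ⁻¹ * NNReal.sqrt C * eLpNorm f 2 volume := by
  have hle := ht.map_flow_le (pow_pos hδ 2)
  refine eLpNorm_two_le ?_
  have hf' := hf.mono_ac (Measure.absolutelyContinuous_of_le hle |>.trans
      Measure.smul_absolutelyContinuous)
  calc _ = ∫⁻ x, ‖f x‖ₑ ^ 2 ∂((μ.prod (volume.restrict (Ioc 0 1))).map (flow v (δ ^ 2))) :=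
        (lintegral_map' (hf'.aemeasurable.enorm.pow_const 2)
          (continuous_flow v _).measurable.aemeasurable).symm
    _ ≤ ∫⁻ x, ‖f x‖ₑ ^ 2 ∂((ENNReal.ofReal (δ ^ 2)⁻¹ * C) • volume) := lintegral_mono' hle le_rfl
    _ = _ := by
        rw [lintegral_smul_measure, lintegral_enorm_sq_eq_eLpNorm, mul_pow, mul_pow,
          ← ENNReal.coe_pow, NNReal.sq_sqrt, ← ENNReal.ofReal_pow (by positivity), inv_pow,
          smul_eq_mul]

/-- The translates of a test function approach its restriction in `L²(μ × ds)` at rate `δ`. -/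
theorem IsTransversal.eLpNorm_flow_test_sub_le (ht : IsTransversal μ v C) {δ : ℝ} (hδ : 0 < δ)
    {z : Jet Ω} (hz : z ∈ H1 Ω) {φ : 𝓓(Ω, ℝ)}
    (hu : z.fst =ᵐ[(volume : Measure (E n)).restrict (Ω : Set (E n))] φ) :
    eLpNorm (fun p => φ (flow v (δ ^ 2) p) - φ p.1) 2 (μ.prod (volume.restrict (Ioc 0 1))) ≤
      ENNReal.ofReal δ * NNReal.sqrt C * (‖v‖ₑ * ‖z‖ₑ) := by
  refine eLpNorm_two_le ?_
  have hm : Measurable fun p : E n × ℝ => ‖φ (flow v (δ ^ 2) p) - φ p.1‖ₑ ^ 2 := by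
    have : Continuous fun p : E n × ℝ => φ (flow v (δ ^ 2) p) - φ p.1 :=
      (φ.continuous.comp (continuous_flow v _)).sub (φ.continuous.comp continuous_fst)
    exact this.measurable.enorm.pow_const 2
  rw [lintegral_prod_symm' _ hm]
  have hR : (ENNReal.ofReal δ * NNReal.sqrt C * (‖v‖ₑ * ‖z‖ₑ)) ^ 2 =
      ENNReal.ofReal (δ ^ 2) * (C * (‖v‖ₑ ^ 2 * ‖z‖ₑ ^ 2)) := by
    rw [mul_pow, mul_pow, mul_pow, ← ENNReal.coe_pow, NNReal.sq_sqrt,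
      ← ENNReal.ofReal_pow hδ.le, mul_assoc]
  rw [hR]
  calc _ ≤ ∫⁻ s in Ioc (0 : ℝ) 1, ENNReal.ofReal (δ ^ 2) * (C * (‖v‖ₑ ^ 2 * ‖z‖ₑ ^ 2)) := by
        refine setLIntegral_mono' measurableSet_Ioc fun s hs => ?_
        refine (ht.lintegral_sub_sq_le (contDiff_one_test φ)
          (mul_nonneg (by positivity) hs.1.le)).trans ?_
        gcongr
        · exact mul_le_of_le_one_right (by positivity) hs.2
        · refine (lintegral_fderiv_test_sq_le hz hu v).trans ?_
          gcongr
          rw [enorm_sq_add z]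
          exact le_add_self
    _ = _ := by simp

theorem enorm_val_sub_le (y z : H10 Ω) : ‖H10.val y - H10.val z‖ₑ ≤ ‖y - z‖ₑ := by
  have : ‖((y - z : H10 Ω) : Jet Ω).fst‖ₑ ^ 2 ≤ ‖((y - z : H10 Ω) : Jet Ω)‖ₑ ^ 2 := by
    rw [enorm_sq_add]; exact le_self_add
  exact (ENNReal.pow_le_pow_left_iff two_ne_zero).1 this

/-- Comparison of a translate of `y ∈ H¹₀(Ω)` with its trace through a test function `z`. -/
theorem IsTransversal.eLpNorm_flow_sub_trace_le (ht : IsTransversal μ v C) (hle : μ ≤ σ)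
    {T : H10 Ω →L[ℝ] Lp ℝ 2 σ} (hT : ∀ z : testSubmodule Ω,
      T (testInclusion Ω z) =ᵐ[σ] testRepr z) (y : H10 Ω) (z : testSubmodule Ω)
    {δ : ℝ} (hδ : 0 < δ) :
    eLpNorm (fun p => zeroExt (H10.val y) (flow v (δ ^ 2) p) - T y p.1) 2
        (μ.prod (volume.restrict (Ioc 0 1))) ≤
      ENNReal.ofReal δ⁻¹ * NNReal.sqrt C * ‖y - testInclusion Ω z‖ₑ +
        ENNReal.ofReal δ * NNReal.sqrt C * (‖v‖ₑ * ‖testInclusion Ω z‖ₑ) +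
        ‖T‖ₑ * ‖y - testInclusion Ω z‖ₑ := by
  set P := μ.prod (volume.restrict (Ioc (0 : ℝ) 1)) with hP
  set z' := testInclusion Ω z
  have hq := ht.quasiMeasurePreserving_flow (pow_pos hδ 2)
  have hmT (w : H10 Ω) : AEStronglyMeasurable (fun p : E n × ℝ => T w p.1) P :=
    ((Lp.aestronglyMeasurable (T w)).mono_measure hle).comp_fst
  have hmz (u : L2 Ω) : AEStronglyMeasurable (zeroExt u ∘ flow v (δ ^ 2)) P :=
    (aestronglyMeasurable_zeroExt u).comp_quasiMeasurePreserving hq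
  have hmA : AEStronglyMeasurable
      ((zeroExt (H10.val y) - zeroExt (H10.val z')) ∘ flow v (δ ^ 2)) P :=
    (hmz _).sub (hmz _)
  have hA : eLpNorm ((zeroExt (H10.val y) - zeroExt (H10.val z')) ∘ flow v (δ ^ 2)) 2 P ≤
      ENNReal.ofReal δ⁻¹ * NNReal.sqrt C * ‖y - z'‖ₑ := by
    refine (ht.eLpNorm_comp_flow_le hδ ((aestronglyMeasurable_zeroExt _).sub
      (aestronglyMeasurable_zeroExt _))).trans ?_
    rw [eLpNorm_zeroExt_sub]
    exact mul_le_mul_right (enorm_val_sub_le y z') _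
  let B : E n × ℝ → ℝ := fun p => testRepr z (flow v (δ ^ 2) p) - testRepr z p.1
  have hmB : AEStronglyMeasurable B P :=
    (((testRepr z).continuous.comp (continuous_flow v _)).sub
      ((testRepr z).continuous.comp continuous_fst)).aestronglyMeasurable
  have hB : eLpNorm B 2 P ≤ ENNReal.ofReal δ * NNReal.sqrt C * (‖v‖ₑ * ‖z'‖ₑ) :=
    ht.eLpNorm_flow_test_sub_le hδ z.2.1 (testRepr_spec z)
  let D : E n × ℝ → ℝ := fun p => T z' p.1 - T y p.1
  have hmD : AEStronglyMeasurable D P := (hmT _).sub (hmT _)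
  have hD : eLpNorm D 2 P ≤ ‖T‖ₑ * ‖y - z'‖ₑ := by
    refine (eLpNorm_comp_fst_sub_le hle (T z') (T y)).trans ?_
    rw [← map_sub, enorm_sub_rev y z']
    exact T.le_opENorm _
  have hTz : ∀ᵐ p ∂P, T z' p.1 = testRepr z p.1 :=
    Measure.quasiMeasurePreserving_fst.ae (ae_mono hle (hT z))
  have hzz : ∀ᵐ p ∂P, zeroExt (H10.val z') (flow v (δ ^ 2) p) = testRepr z (flow v (δ ^ 2) p) :=
    hq.ae (zeroExt_ae_eq (testRepr_spec z))
  -- `y(x + δ² s v) - T y = (y - z)(x + δ² s v) + (z(x + δ² s v) - z(x)) + (T z - T y)`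
  have hsum : (fun p => zeroExt (H10.val y) (flow v (δ ^ 2) p) - T y p.1) =ᵐ[P]
      (zeroExt (H10.val y) - zeroExt (H10.val z')) ∘ flow v (δ ^ 2) + B + D := by
    filter_upwards [hTz, hzz] with p h1 h2
    simp only [B, D, Pi.add_apply, Pi.sub_apply, Function.comp_apply, h1, h2]
    ring
  rw [eLpNorm_congr_ae hsum]
  exact (eLpNorm_add_le (hmA.add hmB) hmD one_le_two).trans
    (add_le_add ((eLpNorm_add_le hmA hmB one_le_two).trans (add_le_add hA hB)) hD)

/-- The translates `y(· + δ² s v)`, `s ∈ (0, 1]`, converge to the trace of `y` in `L²(μ × ds)`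
at rate `δ`. -/
theorem IsTransversal.exists_eLpNorm_flow_sub_trace_le (ht : IsTransversal μ v C) (hle : μ ≤ σ)
    {T : H10 Ω →L[ℝ] Lp ℝ 2 σ} (hT : ∀ z : testSubmodule Ω,
      T (testInclusion Ω z) =ᵐ[σ] testRepr z) (y : H10 Ω) :
    ∃ K : NNReal, ∀ δ : ℝ, 0 < δ → δ ≤ 1 →
      eLpNorm (fun p => zeroExt (H10.val y) (flow v (δ ^ 2) p) - T y p.1) 2
        (μ.prod (volume.restrict (Ioc 0 1))) ≤ ENNReal.ofReal δ * K := by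
  refine ⟨NNReal.sqrt C + NNReal.sqrt C * (‖v‖₊ * (‖y‖₊ + 1)) + ‖T‖₊, fun δ hδ hδ1 => ?_⟩
  -- approximation of `y` to within `δ²` beats the factor `δ⁻¹`
  obtain ⟨z, hz⟩ := (Metric.denseRange_iff.1 (denseRange_testInclusion Ω)) y (δ ^ 2)
    (by positivity)
  have hyz : ‖y - testInclusion Ω z‖ₑ ≤ ENNReal.ofReal (δ ^ 2) := by
    rw [← ofReal_norm, ← dist_eq_norm]
    exact ENNReal.ofReal_le_ofReal hz.le
  have hzn : ‖testInclusion Ω z‖ₑ ≤ ‖y‖ₑ + 1 := by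
    have h1 : ‖testInclusion Ω z‖ₑ ≤ ‖y‖ₑ + ‖y - testInclusion Ω z‖ₑ := by
      simpa using enorm_sub_le (a := y) (b := y - testInclusion Ω z)
    refine h1.trans (add_le_add le_rfl (hyz.trans ?_))
    simpa using ENNReal.ofReal_le_ofReal (show δ ^ 2 ≤ 1 by nlinarith)
  refine (ht.eLpNorm_flow_sub_trace_le hle hT y z hδ).trans ?_
  have h1 : ENNReal.ofReal δ⁻¹ * NNReal.sqrt C * ‖y - testInclusion Ω z‖ₑ ≤
      ENNReal.ofReal δ * NNReal.sqrt C := by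
    calc _ ≤ ENNReal.ofReal δ⁻¹ * NNReal.sqrt C * ENNReal.ofReal (δ ^ 2) :=
          mul_le_mul_right hyz _
      _ = ENNReal.ofReal (δ⁻¹ * δ ^ 2) * NNReal.sqrt C := by
          rw [ENNReal.ofReal_mul (by positivity)]; ring
      _ = _ := by congr 2; field_simp
  have h2 : ENNReal.ofReal δ * NNReal.sqrt C * (‖v‖ₑ * ‖testInclusion Ω z‖ₑ) ≤
      ENNReal.ofReal δ * NNReal.sqrt C * (‖v‖ₑ * (‖y‖ₑ + 1)) :=
    mul_le_mul_right (mul_le_mul_right hzn _) _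
  have h3 : ‖T‖ₑ * ‖y - testInclusion Ω z‖ₑ ≤ ‖T‖ₑ * ENNReal.ofReal δ :=
    mul_le_mul_right (hyz.trans (ENNReal.ofReal_le_ofReal (by nlinarith))) _
  refine (add_le_add (add_le_add h1 h2) h3).trans_eq ?_
  rw [enorm_eq_nnnorm, enorm_eq_nnnorm, enorm_eq_nnnorm]
  push_cast
  ring

/-- The trace of a function with a continuous representative is the restriction of the latter. -/
theorem IsTransversal.trace_ae_eq (ht : IsTransversal μ v C) (hle : μ ≤ σ)
    (hΩ : ∀ᵐ x ∂μ, x ∈ (Ω : Set (E n)))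
    {T : H10 Ω →L[ℝ] Lp ℝ 2 σ} (hT : ∀ z : testSubmodule Ω,
      T (testInclusion Ω z) =ᵐ[σ] testRepr z) {y : H10 Ω} {f : E n → ℝ}
    (hf : ContinuousOn f (Ω : Set (E n)))
    (hyf : H10.val y =ᵐ[(volume : Measure (E n)).restrict (Ω : Set (E n))] f) :
    T y =ᵐ[μ] f := by
  obtain ⟨K, hK⟩ := ht.exists_eLpNorm_flow_sub_trace_le hle hT y
  set P := μ.prod (volume.restrict (Ioc (0 : ℝ) 1)) with hP
  let δ : ℕ → ℝ := fun k => 1 / ((k : ℝ) + 1)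
  have hδ0 (k) : 0 < δ k := Nat.one_div_pos_of_nat
  have hδ1 (k) : δ k ≤ 1 := by
    simpa [δ] using Nat.one_div_le_one_div (α := ℝ) (Nat.zero_le k)
  have hδ : Tendsto δ atTop (𝓝 0) := tendsto_one_div_add_atTop_nhds_zero_nat
  have hm (k : ℕ) : AEStronglyMeasurable
      (fun p => zeroExt (H10.val y) (flow v (δ k ^ 2) p) - T y p.1) P :=
    ((aestronglyMeasurable_zeroExt _).comp_quasiMeasurePreserving
      (ht.quasiMeasurePreserving_flow (pow_pos (hδ0 k) 2))).sub
      ((Lp.aestronglyMeasurable (T y)).mono_measure hle).comp_fst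
  -- the translates stay in `Ω` eventually, and they avoid the null set where `y ≠ f`
  have hlim : ∀ᵐ p ∂P, Tendsto
      (fun k => zeroExt (H10.val y) (flow v (δ k ^ 2) p) - T y p.1) atTop
      (𝓝 (f p.1 - T y p.1)) := by
    have h1 : ∀ᵐ p ∂P, p.1 ∈ (Ω : Set (E n)) := Measure.quasiMeasurePreserving_fst.ae hΩ
    have h2 : ∀ᵐ p ∂P, ∀ k, flow v (δ k ^ 2) p ∈ (Ω : Set (E n)) →
        H10.val y (flow v (δ k ^ 2) p) = f (flow v (δ k ^ 2) p) :=
      ae_all_iff.2 fun k => (ht.quasiMeasurePreserving_flow (pow_pos (hδ0 k) 2)).ae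
        ((ae_restrict_iff' Ω.isOpen.measurableSet).1 hyf)
    filter_upwards [h1, h2] with p hp1 hp2
    have hc : Continuous fun t : ℝ => flow v (t ^ 2) p := by unfold flow; fun_prop
    have hfl : Tendsto (fun k => flow v (δ k ^ 2) p) atTop (𝓝 p.1) := by
      have := (hc.tendsto 0).comp hδ
      simpa [flow, Function.comp_def] using this
    have hfc : ContinuousAt f p.1 := hf.continuousAt (Ω.isOpen.mem_nhds hp1)
    refine Tendsto.sub_const ((hfc.tendsto.comp hfl).congr' ?_) _
    filter_upwards [hfl.eventually (Ω.isOpen.mem_nhds hp1)] with k hk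
    have hk' : flow v (δ k ^ 2) p ∈ (Ω : Set (E n)) := hk
    simp only [Function.comp_apply, zeroExt]
    rw [indicator_of_mem hk', hp2 k hk']
  -- Fatou's lemma
  have hzero : eLpNorm (fun p : E n × ℝ => f p.1 - T y p.1) 2 P = 0 := by
    refine le_antisymm ((Lp.eLpNorm_lim_le_liminf_eLpNorm hm _ hlim).trans ?_) zero_le
    have h1 : Tendsto (fun k => ENNReal.ofReal (δ k) * K) atTop (𝓝 0) := by
      simpa using ENNReal.Tendsto.mul_const (ENNReal.tendsto_ofReal hδ) (b := (K : ℝ≥0∞))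
        (Or.inr ENNReal.coe_ne_top)
    rw [← h1.liminf_eq]
    exact liminf_le_liminf (Eventually.of_forall fun k => hK _ (hδ0 k) (hδ1 k))
  rw [eLpNorm_eq_zero_iff (aestronglyMeasurable_of_tendsto_ae atTop hm hlim) (by norm_num)] at hzero
  filter_upwards [Measure.ae_ae_of_ae_prod hzero] with x hx
  have : NeBot (ae ((volume : Measure ℝ).restrict (Ioc 0 1))) := by
    rw [ae_neBot, Ne, Measure.restrict_eq_zero]
    simp
  obtain ⟨s, hs⟩ := hx.exists
  exact (sub_eq_zero.1 hs).symm

end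

/-- A bounded operator on `H¹₀(Ω)` restricting test functions to `Γ` is unique. -/
theorem isTrace_unique {n : ℕ} {Ω : Opens (E n)} {Γ : Set (E n)} {T T' : H10 Ω →L[ℝ] L2Surface Γ}
    (hT : IsTrace T) (hT' : IsTrace T') : T = T' := by
  have h : (T : H10 Ω → L2Surface Γ) = T' := by
    refine (denseRange_testInclusion Ω).equalizer T.continuous T'.continuous ?_
    ext1 z
    refine Lp.ext ?_
    have hc : ContinuousOn (testRepr z) (Ω : Set (E n)) := (testRepr z).continuous.continuousOn
    exact (hT (testInclusion Ω z) _ hc (testRepr_spec z)).trans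
      (hT' (testInclusion Ω z) _ hc (testRepr_spec z)).symm
  exact DFunLike.coe_injective h

/-- The trace operator exists and is unique as soon as `Γ ⊆ Ω` lies on the boundary of a bounded set
with Lipschitz boundary. -/
theorem existsUnique_isTrace {n : ℕ} {Ω : Opens (E n)} {Γ U : Set (E n)}
    (hU : Bornology.IsBounded U) (hL : HasLipschitzBoundary U) (hΓ : Γ ⊆ frontier U)
    (hΓΩ : Γ ⊆ (Ω : Set (E n))) :
    ∃! T : H10 Ω →L[ℝ] L2Surface Γ, IsTrace T := by
  obtain ⟨T, hT⟩ := exists_trace_on_test (Ω := Ω) hU hL hΓ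
  have htr : IsTrace T := by
    intro y f hf hyf
    obtain ⟨t, V, hcov, hV⟩ := exists_transversal_cover hU hL hΓ
    have hΩ : ∀ᵐ x ∂surfaceMeasure Γ, x ∈ (Ω : Set (E n)) :=
      (ae_restrict_iff Ω.isOpen.measurableSet).2 (Eventually.of_forall hΓΩ)
    have key : ∀ᵐ x ∂(surfaceMeasure Γ).restrict (⋃ i, V i), T y x = f x := by
      rw [ae_restrict_iUnion_iff]
      intro i
      obtain ⟨v, C, hfin, htr⟩ := hV i
      exact htr.trace_ae_eq Measure.restrict_le_self (ae_mono Measure.restrict_le_self hΩ) hT hf hyf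
    rwa [Measure.restrict_eq_self_of_ae_mem hcov] at key
  exact ⟨T, htr, fun T' hT' => isTrace_unique hT' htr⟩

/-! ### The control-to-state operator -/

section

variable {n : ℕ} {Ω : Opens (E n)}

/-- `H10.val` as a continuous linear map. -/
noncomputable def valL (Ω : Opens (E n)) : H10 Ω →L[ℝ] L2 Ω :=
  (WithLp.fstL 2 ℝ (L2 Ω) (PiLp 2 fun _ : Fin n => L2 Ω)).comp (H10 Ω).subtypeL

/-- `H10.grad · i` as a continuous linear map. -/
noncomputable def gradL (Ω : Opens (E n)) (i : Fin n) : H10 Ω →L[ℝ] L2 Ω :=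
  (PiLp.proj 2 (fun _ : Fin n => L2 Ω) i).comp
    ((WithLp.sndL 2 ℝ (L2 Ω) (PiLp 2 fun _ : Fin n => L2 Ω)).comp (H10 Ω).subtypeL)

theorem valL_apply (y : H10 Ω) : valL Ω y = H10.val y := rfl

theorem gradL_apply (i : Fin n) (y : H10 Ω) : gradL Ω i y = H10.grad y i := rfl

theorem norm_sq_H10 (y : H10 Ω) :
    ‖y‖ ^ 2 = ‖H10.val y‖ ^ 2 + ∑ i, ‖H10.grad y i‖ ^ 2 := by
  have h : ‖(y : Jet Ω)‖ ^ 2 = ‖(y : Jet Ω).fst‖ ^ 2 + ∑ i, ‖(y : Jet Ω).snd i‖ ^ 2 := by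
    rw [WithLp.prod_norm_sq_eq_of_L2, PiLp.norm_sq_eq_of_L2]
  exact h

/-- The Poincaré inequality on `H¹₀(Ω)`. -/
theorem poincare_H10 (hn : n ≠ 0) (hΩ : Bornology.IsBounded (Ω : Set (E n))) :
    ∃ C : ℝ, 0 < C ∧ ∀ y : H10 Ω, ‖y‖ ^ 2 ≤ C * ∑ i, ‖H10.grad y i‖ ^ 2 := by
  obtain ⟨r, hr0, hr⟩ := hΩ.subset_ball_lt 0 0
  set R : ℝ := 2 * r with hR
  have hRpos : 0 < R := by positivity
  set v : E n := EuclideanSpace.single ⟨0, Nat.pos_of_ne_zero hn⟩ 1 with hv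
  have hvn : ‖v‖ = 1 := by simp [hv]
  -- a translation by the diameter of `Ω` moves `Ω` off itself
  have hout (x : E n) (hx : x ∈ (Ω : Set (E n))) : x + R • v ∉ (Ω : Set (E n)) := by
    intro h
    have h1 := hr hx
    have h2 := hr h
    rw [mem_ball_zero_iff] at h1 h2
    have h3 : ‖R • v‖ ≤ ‖x + R • v‖ + ‖x‖ := by
      simpa using norm_sub_le (x + R • v) x
    rw [norm_smul, hvn, Real.norm_of_nonneg hRpos.le] at h3
    linarith
  refine ⟨R ^ 2 + 1, by positivity, fun y => ?_⟩
  refine isClosed_property (denseRange_testInclusion Ω)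
    (p := fun y : H10 Ω => ‖y‖ ^ 2 ≤ (R ^ 2 + 1) * ∑ i, ‖H10.grad y i‖ ^ 2)
    (isClosed_le (by fun_prop) ?_) (fun z => ?_) y
  · exact continuous_const.mul (continuous_finsetSum _ fun i _ =>
      ((gradL Ω i).continuous.norm.pow 2))
  have hφ := testRepr_spec z
  have h1 := poincare_lintegral (contDiff_one_test (testRepr z)) hRpos.le (v := v) fun x hx =>
    test_eq_zero _ (hout x (by_contra fun h => hx (test_eq_zero _ h)))
  have h2 := lintegral_fderiv_test_sq_le z.2.1 hφ v
  have hv1 : ‖v‖ₑ = 1 := by rw [← ofReal_norm, hvn, ENNReal.ofReal_one]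
  rw [hv1, one_pow, one_mul] at h2
  rw [lintegral_test_sq hφ] at h1
  have h3 : ‖(z : Jet Ω).fst‖ ^ 2 ≤ R * (R * ∑ i, ‖(z : Jet Ω).snd i‖ ^ 2) := by
    have h4 := h1.trans (mul_le_mul_right (mul_le_mul_right h2 _) _)
    simp only [← ofReal_norm, ← ENNReal.ofReal_pow (norm_nonneg _)] at h4
    rwa [← ENNReal.ofReal_sum_of_nonneg (fun _ _ => by positivity),
      ← ENNReal.ofReal_mul hRpos.le, ← ENNReal.ofReal_mul hRpos.le,
      ENNReal.ofReal_le_ofReal_iff (by positivity)] at h4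
  rw [norm_sq_H10]
  have h5 : ‖H10.val (testInclusion Ω z)‖ ^ 2 ≤
    R * (R * ∑ i, ‖H10.grad (testInclusion Ω z) i‖ ^ 2) := h3
  linarith

/-- Multiplication by a bounded coefficient on `L²(Ω)`. -/
noncomputable def mulL {c : E n → ℝ}
    (hc : MemLp c ⊤ ((volume : Measure (E n)).restrict (Ω : Set (E n)))) : L2 Ω →L[ℝ] L2 Ω :=
  (ContinuousLinearMap.mul ℝ ℝ).holderL _ ⊤ 2 2 (hc.toLp c)

theorem mulL_ae_eq {c : E n → ℝ}
    (hc : MemLp c ⊤ ((volume : Measure (E n)).restrict (Ω : Set (E n)))) (u : L2 Ω) :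
    mulL hc u =ᵐ[(volume : Measure (E n)).restrict (Ω : Set (E n))] fun x => c x * u x := by
  have h := (ContinuousLinearMap.mul ℝ ℝ).coeFn_holder (r := 2) (hc.toLp c) u
  filter_upwards [h, hc.coeFn_toLp] with x h1 h2
  rw [mulL, ContinuousLinearMap.holderL_apply_apply, h1, h2]
  rfl

theorem integrable_coeff_mul {c : E n → ℝ}
    (hc : MemLp c ⊤ ((volume : Measure (E n)).restrict (Ω : Set (E n)))) (u w : L2 Ω) :
    Integrable (fun x => c x * u x * w x) ((volume : Measure (E n)).restrict (Ω : Set (E n))) := by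
  refine ((Lp.memLp (mulL hc u)).integrable_mul (Lp.memLp w)).congr ?_
  filter_upwards [mulL_ae_eq hc u] with x hx
  simp [hx]

theorem inner_mulL {c : E n → ℝ}
    (hc : MemLp c ⊤ ((volume : Measure (E n)).restrict (Ω : Set (E n)))) (u w : L2 Ω) :
    inner ℝ (mulL hc u) w = ∫ x in (Ω : Set (E n)), c x * u x * w x := by
  rw [L2.inner_def]
  refine integral_congr_ae ?_
  filter_upwards [mulL_ae_eq hc u] with x hx
  simp [hx, mul_comm]

variable {a : Fin n → Fin n → E n → ℝ} {a₀ : E n → ℝ}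

/-- `bilin a a₀` as a bilinear form. -/
noncomputable def bilinForm
    (ha : ∀ i j, MemLp (a i j) ⊤ ((volume : Measure (E n)).restrict (Ω : Set (E n))))
    (ha₀ : MemLp a₀ ⊤ ((volume : Measure (E n)).restrict (Ω : Set (E n)))) :
    H10 Ω →ₗ[ℝ] H10 Ω →ₗ[ℝ] ℝ :=
  (∑ i, ∑ j, (innerₗ (L2 Ω)).compl₁₂ ((mulL (ha i j)).toLinearMap ∘ₗ (gradL Ω i).toLinearMap)
    (gradL Ω j).toLinearMap) +
    (innerₗ (L2 Ω)).compl₁₂ ((mulL ha₀).toLinearMap ∘ₗ (valL Ω).toLinearMap) (valL Ω).toLinearMap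

theorem bilinForm_apply_inner
    (ha : ∀ i j, MemLp (a i j) ⊤ ((volume : Measure (E n)).restrict (Ω : Set (E n))))
    (ha₀ : MemLp a₀ ⊤ ((volume : Measure (E n)).restrict (Ω : Set (E n)))) (z v : H10 Ω) :
    bilinForm ha ha₀ z v =
      (∑ i, ∑ j, inner ℝ (mulL (ha i j) (H10.grad z i)) (H10.grad v j)) +
        inner ℝ (mulL ha₀ (H10.val z)) (H10.val v) := by
  simp [bilinForm, valL_apply, gradL_apply]

theorem bilinForm_apply
    (ha : ∀ i j, MemLp (a i j) ⊤ ((volume : Measure (E n)).restrict (Ω : Set (E n))))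
    (ha₀ : MemLp a₀ ⊤ ((volume : Measure (E n)).restrict (Ω : Set (E n)))) (z v : H10 Ω) :
    bilinForm ha ha₀ z v = bilin a a₀ z v := by
  simp only [bilinForm_apply_inner, bilin, inner_mulL]

theorem norm_val_le (y : H10 Ω) : ‖H10.val y‖ ≤ ‖y‖ := by
  refine (abs_le_of_sq_le_sq' ?_ (norm_nonneg _)).2
  rw [norm_sq_H10 y]
  exact le_add_of_nonneg_right (by positivity)

theorem norm_grad_le (y : H10 Ω) (i : Fin n) : ‖H10.grad y i‖ ≤ ‖y‖ := by
  refine (abs_le_of_sq_le_sq' ?_ (norm_nonneg _)).2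
  rw [norm_sq_H10 y]
  exact le_add_of_nonneg_of_le (by positivity)
    (Finset.single_le_sum (f := fun i => ‖H10.grad y i‖ ^ 2) (fun _ _ => by positivity)
      (Finset.mem_univ i))

theorem norm_bilinForm_le
    (ha : ∀ i j, MemLp (a i j) ⊤ ((volume : Measure (E n)).restrict (Ω : Set (E n))))
    (ha₀ : MemLp a₀ ⊤ ((volume : Measure (E n)).restrict (Ω : Set (E n)))) (z v : H10 Ω) :
    ‖bilinForm ha ha₀ z v‖ ≤
      ((∑ i, ∑ j, ‖mulL (ha i j)‖) + ‖mulL ha₀‖) * ‖z‖ * ‖v‖ := by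
  have key (M : L2 Ω →L[ℝ] L2 Ω) (u w : L2 Ω) (hu : ‖u‖ ≤ ‖z‖) (hw : ‖w‖ ≤ ‖v‖) :
      ‖(inner ℝ (M u) w : ℝ)‖ ≤ ‖M‖ * ‖z‖ * ‖v‖ :=
    (norm_inner_le_norm _ _).trans (mul_le_mul ((M.le_opNorm u).trans
      (mul_le_mul_of_nonneg_left hu (norm_nonneg _))) hw (norm_nonneg _) (by positivity))
  rw [bilinForm_apply_inner, add_mul, add_mul]
  simp only [Finset.sum_mul]
  refine norm_add_le_of_le (norm_sum_le_of_le _ fun i _ => norm_sum_le_of_le _ fun j _ => ?_) ?_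
  · exact key _ _ _ (norm_grad_le z i) (norm_grad_le v j)
  · exact key _ _ _ (norm_val_le z) (norm_val_le v)

/-- Ellipticity of the coefficients, integrated over `Ω`. -/
theorem le_bilin_self
    (ha : ∀ i j, MemLp (a i j) ⊤ ((volume : Measure (E n)).restrict (Ω : Set (E n))))
    (ha₀_nonneg : ∀ᵐ x ∂(volume : Measure (E n)).restrict (Ω : Set (E n)), 0 ≤ a₀ x)
    {α : ℝ} (hα : ∀ x ∈ Ω, ∀ ξ : E n, α * ‖ξ‖ ^ 2 ≤ ∑ i, ∑ j, a i j x * ξ i * ξ j)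
    (z : H10 Ω) : α * ∑ i, ‖H10.grad z i‖ ^ 2 ≤ bilin a a₀ z z := by
  have h0 : 0 ≤ ∫ x in (Ω : Set (E n)), a₀ x * H10.val z x * H10.val z x := by
    refine integral_nonneg_of_ae ?_
    filter_upwards [ha₀_nonneg] with x hx
    rw [mul_assoc]
    exact mul_nonneg hx (mul_self_nonneg _)
  have hint (i j) := integrable_coeff_mul (ha i j) (H10.grad z i) (H10.grad z j)
  have hsq (i) : ‖H10.grad z i‖ ^ 2 = ∫ x in (Ω : Set (E n)), H10.grad z i x ^ 2 := by
    rw [← real_inner_self_eq_norm_sq, L2.inner_def]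
    simp [sq]
  have hisq (i) : Integrable (fun x => H10.grad z i x ^ 2)
      ((volume : Measure (E n)).restrict (Ω : Set (E n))) := (Lp.memLp _).integrable_sq
  have h1 : α * ∑ i, ‖H10.grad z i‖ ^ 2 ≤
      ∑ i, ∑ j, ∫ x in (Ω : Set (E n)), a i j x * H10.grad z i x * H10.grad z j x := by
    simp_rw [hsq]
    rw [← integral_finsetSum _ fun i _ => hisq i, ← integral_const_mul,
      Finset.sum_congr rfl fun i _ => (integral_finsetSum _ fun j _ => hint i j).symm,
      ← integral_finsetSum _ fun i _ => integrable_finsetSum _ fun j _ => hint i j]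
    refine setIntegral_mono_on ((integrable_finsetSum _ fun i _ => hisq i).const_mul α)
      (integrable_finsetSum _ fun i _ => integrable_finsetSum _ fun j _ => hint i j)
      Ω.isOpen.measurableSet fun x hx => ?_
    have h := hα x hx (WithLp.toLp 2 fun i => H10.grad z i x)
    simpa [EuclideanSpace.norm_sq_eq] using h
  rw [bilin]
  linarith

/-- Lax–Milgram for the functionals `v ↦ ⟪η, ι v⟫`. The data are linear maps with norm bounds rather
than continuous linear maps, because on `H10 Ω` the topology inherited from the product and the one
coming from the norm are different (though equal) terms. -/
theorem laxMilgram_solution_operator {V W : Type*} [NormedAddCommGroup V]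
    [InnerProductSpace ℝ V] [CompleteSpace V] [NormedAddCommGroup W] [InnerProductSpace ℝ W]
    [CompleteSpace W] (b : V →ₗ[ℝ] V →ₗ[ℝ] ℝ) {M c : ℝ} (hM : ∀ z v, ‖b z v‖ ≤ M * ‖z‖ * ‖v‖)
    (hc : 0 < c) (hb : ∀ z, c * ‖z‖ ^ 2 ≤ b z z) (ι : V →ₗ[ℝ] W) (hι : ∀ v, ‖ι v‖ ≤ ‖v‖) :
    ∃ S : W →ₗ[ℝ] V, (∃ K : ℝ, ∀ η, ‖S η‖ ≤ K * ‖η‖) ∧ (∀ η v, b (S η) v = inner ℝ η (ι v)) ∧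
      ∀ S' : W → V, (∀ η v, b (S' η) v = inner ℝ η (ι v)) → S' = S := by
  let B : V →L[ℝ] V →L[ℝ] ℝ := LinearMap.mkContinuous₂ b M hM
  have hB : IsCoercive B := ⟨c, hc, fun z => by rw [mul_assoc, ← sq]; exact hb z⟩
  let j : V →L[ℝ] W := LinearMap.mkContinuous ι 1 fun v => by simpa using hι v
  let S : W →L[ℝ] V := (hB.continuousLinearEquivOfBilin.symm : V →L[ℝ] V).comp
    (ContinuousLinearMap.adjoint j)
  refine ⟨S, ⟨‖S‖, S.le_opNorm⟩, fun η v => ?_, fun S' hS' => ?_⟩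
  · have h : B (S η) v = inner ℝ η (j v) := by
      rw [← hB.continuousLinearEquivOfBilin_apply]
      simp [S, ContinuousLinearMap.adjoint_inner_left]
    exact h
  · funext η
    have h : ContinuousLinearMap.adjoint j η = hB.continuousLinearEquivOfBilin (S' η) := by
      refine hB.unique_continuousLinearEquivOfBilin fun w => ?_
      rw [ContinuousLinearMap.adjoint_inner_left]
      exact (hS' η w).symm
    simp [S, h]

/-- The control-to-state operator exists, is unique, and is linear and bounded. -/
theorem exists_controlToState (hn : n ≠ 0) (hΩ : Bornology.IsBounded (Ω : Set (E n)))
    (ha : ∀ i j, MemLp (a i j) ⊤ ((volume : Measure (E n)).restrict (Ω : Set (E n))))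
    (ha₀ : MemLp a₀ ⊤ ((volume : Measure (E n)).restrict (Ω : Set (E n))))
    (ha₀_nonneg : ∀ᵐ x ∂(volume : Measure (E n)).restrict (Ω : Set (E n)), 0 ≤ a₀ x)
    (ha_ell : ∃ α > 0, ∀ x ∈ Ω, ∀ ξ : E n, α * ‖ξ‖ ^ 2 ≤ ∑ i, ∑ j, a i j x * ξ i * ξ j) :
    ∃ S : L2 Ω →ₗ[ℝ] H10 Ω, (∃ K : ℝ, ∀ η, ‖S η‖ ≤ K * ‖η‖) ∧
      IsControlToState a a₀ (fun η => S η) ∧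
      ∀ S' : L2 Ω → H10 Ω, IsControlToState a a₀ S' → S' = fun η => S η := by
  obtain ⟨α, hα, hell⟩ := ha_ell
  obtain ⟨C, hC, hP⟩ := poincare_H10 (Ω := Ω) hn hΩ
  have hco (z : H10 Ω) : α / C * ‖z‖ ^ 2 ≤ bilinForm ha ha₀ z z := by
    rw [bilinForm_apply]
    refine le_trans ?_ (le_bilin_self ha ha₀_nonneg hell z)
    rw [div_mul_eq_mul_div, div_le_iff₀ hC]
    nlinarith [hP z]
  have hι (v : H10 Ω) : ‖(valL Ω).toLinearMap v‖ ≤ ‖v‖ := norm_val_le v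
  -- applied to the spaces alone, so that their instances are found before the forms are compared
  have lm := @laxMilgram_solution_operator (H10 Ω) (L2 Ω) _ _ _ _ _ _
  obtain ⟨S, hK, hS, huniq⟩ := lm (bilinForm ha ha₀) (norm_bilinForm_le ha ha₀) (div_pos hα hC)
    hco (valL Ω).toLinearMap hι
  exact ⟨S, hK, fun η v => (bilinForm_apply ha ha₀ _ _).symm.trans (hS η v), fun S' hS' =>
    huniq S' fun η v => (bilinForm_apply ha ha₀ _ _).trans (hS' η v)⟩

/-- Lipschitz coefficients on the compact set `closure Ω` are bounded. -/
theorem memLp_top_of_lipschitz (hΩ : Bornology.IsBounded (Ω : Set (E n))) {c : E n → ℝ}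
    (hc : ∃ K, LipschitzOnWith K c (closure (Ω : Set (E n)))) :
    MemLp c ⊤ ((volume : Measure (E n)).restrict (Ω : Set (E n))) := by
  obtain ⟨K, hK⟩ := hc
  obtain ⟨M, hM⟩ := hΩ.isCompact_closure.exists_bound_of_continuousOn hK.continuousOn
  refine memLp_top_of_bound ((hK.continuousOn.mono subset_closure).aestronglyMeasurable
    Ω.isOpen.measurableSet) M ?_
  exact ae_restrict_of_forall_mem Ω.isOpen.measurableSet fun x hx => hM x (subset_closure hx)

end

/-! ### Existence and uniqueness of the optimal control -/

/-- The Tikhonov functional attains its minimum over a nonempty closed convex set at exactly one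
point. Up to a constant it is the squared distance from `(g, 0)` to `(L u, √ν u)`, so a minimiser
is a projection onto a closed convex set; uniqueness is the parallelogram identity. -/
theorem existsUnique_tikhonov {H G : Type*} [NormedAddCommGroup H] [InnerProductSpace ℝ H]
    [CompleteSpace H] [NormedAddCommGroup G] [InnerProductSpace ℝ G] [CompleteSpace G]
    {K : Set H} (hne : K.Nonempty) (hcl : IsClosed K) (hcv : Convex ℝ K) (L : H →L[ℝ] G) (g : G)
    {ν : ℝ} (hν : 0 < ν) :
    ∃! u : H, u ∈ K ∧ ∀ η ∈ K,
      1 / 2 * ‖L u - g‖ ^ 2 + ν / 2 * ‖u‖ ^ 2 ≤ 1 / 2 * ‖L η - g‖ ^ 2 + ν / 2 * ‖η‖ ^ 2 := by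
  set c := √ν with hc
  have hcp : 0 < c := Real.sqrt_pos.2 hν
  have hc2 : c ^ 2 = ν := Real.sq_sqrt hν.le
  -- for `p = (y, c η)` these are `D p = η` and `Q p = y - L η`
  let D : WithLp 2 (G × H) →L[ℝ] H := c⁻¹ • WithLp.sndL 2 ℝ G H
  let Q : WithLp 2 (G × H) →L[ℝ] G := WithLp.fstL 2 ℝ G H - L.comp D
  let A : Set (WithLp 2 (G × H)) := D ⁻¹' K ∩ {p | Q p = 0}
  have hAcl : IsClosed A :=
    (hcl.preimage D.continuous).inter (isClosed_eq Q.continuous continuous_const)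
  have hAcv : Convex ℝ A :=
    (hcv.linear_preimage D.toLinearMap).inter (LinearMap.ker Q.toLinearMap).convex
  have hmem (η : H) (hη : η ∈ K) : (WithLp.toLp 2 (L η, c • η) : WithLp 2 (G × H)) ∈ A := by
    have hD : D (WithLp.toLp 2 (L η, c • η)) = η := by
      simp [D, smul_smul, inv_mul_cancel₀ hcp.ne']
    refine ⟨by rw [mem_preimage, hD]; exact hη, ?_⟩
    simp [Q, hD]
  have hdist (η : H) :
      ‖(WithLp.toLp 2 (g, 0) : WithLp 2 (G × H)) - WithLp.toLp 2 (L η, c • η)‖ ^ 2 =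
      ‖L η - g‖ ^ 2 + ν * ‖η‖ ^ 2 := by
    rw [WithLp.prod_norm_sq_eq_of_L2]
    simp [norm_sub_rev g, norm_smul, mul_pow, hc2]
  obtain ⟨η₀, hη₀⟩ := hne
  obtain ⟨p, hpA, hp⟩ := exists_norm_eq_iInf_of_complete_convex ⟨_, hmem η₀ hη₀⟩
    hAcl.isComplete hAcv (WithLp.toLp 2 (g, 0))
  have hpeq : p = WithLp.toLp 2 (L (D p), c • D p) := by
    have h1 : p.fst = L (D p) := sub_eq_zero.1 hpA.2
    have h2 : p.snd = c • D p := by simp [D, smul_smul, mul_inv_cancel₀ hcp.ne']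
    rw [← h1, ← h2]
    rfl
  have hmin (η : H) (hη : η ∈ K) :
      ‖L (D p) - g‖ ^ 2 + ν * ‖D p‖ ^ 2 ≤ ‖L η - g‖ ^ 2 + ν * ‖η‖ ^ 2 := by
    rw [← hdist, ← hdist, ← hpeq]
    refine pow_le_pow_left₀ (norm_nonneg _) ?_ 2
    rw [hp]
    exact ciInf_le ⟨0, forall_mem_range.2 fun _ => norm_nonneg _⟩
      (⟨_, hmem η hη⟩ : A)
  refine ⟨D p, ⟨hpA.1, fun η hη => by linarith [hmin η hη]⟩, fun w hw => ?_⟩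
  have hmid : (1 / 2 : ℝ) • D p + (1 / 2 : ℝ) • w ∈ K :=
    hcv hpA.1 hw.1 (by norm_num) (by norm_num) (by norm_num)
  have h1 := hmin _ hmid
  have h2 := hw.2 _ hpA.1
  have e1 : L ((1 / 2 : ℝ) • D p + (1 / 2 : ℝ) • w) - g =
      (1 / 2 : ℝ) • ((L (D p) - g) + (L w - g)) := by
    rw [map_add, map_smul, map_smul]; module
  have e2 : (1 / 2 : ℝ) • D p + (1 / 2 : ℝ) • w = (1 / 2 : ℝ) • (D p + w) := by module
  rw [e1, e2, norm_smul, norm_smul] at h1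
  have p1 := parallelogram_law_with_norm ℝ (L (D p) - g) (L w - g)
  have p2 := parallelogram_law_with_norm ℝ (D p) w
  have hn : ‖(1 / 2 : ℝ)‖ = 1 / 2 := by norm_num
  rw [hn, mul_pow, mul_pow] at h1
  have h3 : ν * (‖D p - w‖ * ‖D p - w‖) ≤ 0 := by
    nlinarith [mul_self_nonneg ‖(L (D p) - g) - (L w - g)‖]
  have h4 : ‖D p - w‖ * ‖D p - w‖ ≤ 0 := nonpos_of_mul_nonpos_right h3 hν
  have h5 : ‖D p - w‖ = 0 := mul_self_eq_zero.1 (le_antisymm h4 (mul_self_nonneg _))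
  exact (sub_eq_zero.1 (norm_eq_zero.1 h5)).symm

theorem convex_admissible {n : ℕ} (Ω : Opens (E n)) (lo hi : EReal) :
    Convex ℝ (admissible Ω lo hi) := by
  intro u hu w hw s t hs ht hst
  -- real points of an interval of `EReal` form an order connected, hence convex, set
  have hord : OrdConnected {r : ℝ | lo ≤ (r : EReal) ∧ (r : EReal) ≤ hi} := by
    refine ⟨fun r hr q hq p hp => ⟨hr.1.trans ?_, le_trans ?_ hq.2⟩⟩
    · exact EReal.coe_le_coe_iff.2 hp.1
    · exact EReal.coe_le_coe_iff.2 hp.2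
  show ∀ᵐ x ∂_, _
  filter_upwards [hu, hw, Lp.coeFn_add (s • u) (t • w), Lp.coeFn_smul s u, Lp.coeFn_smul t w]
    with x h1 h2 h3 h4 h5
  rw [h3, Pi.add_apply, h4, h5]
  exact hord.convex h1 h2 hs ht hst

theorem isClosed_admissible {n : ℕ} (Ω : Opens (E n)) (lo hi : EReal) :
    IsClosed (admissible Ω lo hi) := by
  refine IsSeqClosed.isClosed fun u w hu hw => ?_
  -- convergence in `L²` gives almost everywhere convergence along a subsequence
  obtain ⟨ns, -, hns⟩ := (tendstoInMeasure_of_tendsto_Lp hw).exists_seq_tendsto_ae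
  show ∀ᵐ x ∂_, _
  filter_upwards [hns, ae_all_iff.2 fun k => hu (ns k)] with x hx hk
  have hx' := (continuous_coe_real_ereal.tendsto _).comp hx
  exact ⟨ge_of_tendsto' hx' fun k => (hk k).1, le_of_tendsto' hx' fun k => (hk k).2⟩

theorem admissible_nonempty {n : ℕ} {Ω : Opens (E n)} (hΩ : Bornology.IsBounded (Ω : Set (E n)))
    {lo hi : EReal} {r : ℝ} (h1 : lo ≤ r) (h2 : r ≤ hi) : (admissible Ω lo hi).Nonempty := by
  have : IsFiniteMeasure ((volume : Measure (E n)).restrict (Ω : Set (E n))) :=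
    ⟨by simpa using hΩ.measure_lt_top⟩
  refine ⟨(memLp_const r).toLp, ?_⟩
  show ∀ᵐ x ∂_, _
  filter_upwards [(memLp_const r).coeFn_toLp] with x hx
  rw [hx]
  exact ⟨h1, h2⟩

/-- The reduced control problem, for a linear and bounded control-to-state operator, has exactly
one solution. -/
theorem existsUnique_optimal_control {n : ℕ} {Ω : Opens (E n)}
    (hΩ : Bornology.IsBounded (Ω : Set (E n))) {Γ : Set (E n)} (S : L2 Ω →ₗ[ℝ] H10 Ω) {K : ℝ}
    (hK : ∀ η, ‖S η‖ ≤ K * ‖η‖) (T : H10 Ω →L[ℝ] L2Surface Γ) (g : L2Surface Γ) {lo hi : EReal}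
    {r : ℝ} (hlo : lo ≤ r) (hhi : r ≤ hi) {ν : ℝ} (hν : 0 < ν) :
    ∃! u : L2 Ω, u ∈ admissible Ω lo hi ∧
      ∀ η ∈ admissible Ω lo hi,
        reducedCost (fun η => S η) T g ν u ≤ reducedCost (fun η => S η) T g ν η := by
  have hb (η : L2 Ω) : ‖(T.toLinearMap ∘ₗ S) η‖ ≤ ‖T‖ * K * ‖η‖ := by
    rw [mul_assoc]
    exact (T.le_opNorm (S η)).trans (mul_le_mul_of_nonneg_left (hK η) T.opNorm_nonneg)
  exact existsUnique_tikhonov (admissible_nonempty hΩ hlo hhi) (isClosed_admissible Ω lo hi)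
    (convex_admissible Ω lo hi) ((T.toLinearMap ∘ₗ S).mkContinuous _ hb) g hν

end LineControl

/-- The control-to-state operator `S` and the trace operator `T` exist and are unique, and the
reduced problem `min Ĵ(η)` over the admissible set has exactly one solution. -/
theorem theorem3p1 {n : ℕ} (hn : n = 2 ∨ n = 3)
    (Ω : Opens (E n)) (hΩ : Bornology.IsBounded (Ω : Set (E n)))
    -- the coefficients of the elliptic operator
    (a : Fin n → Fin n → E n → ℝ) (a₀ : E n → ℝ)
    (ha₀ : MemLp a₀ ⊤ ((volume : Measure (E n)).restrict (Ω : Set (E n))))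
    (ha₀_nonneg : ∀ᵐ x ∂(volume : Measure (E n)).restrict (Ω : Set (E n)), 0 ≤ a₀ x)
    (ha_symm : ∀ i j, ∀ x ∈ closure (Ω : Set (E n)), a i j x = a j i x)
    (ha_lip : ∀ i j, ∃ K, LipschitzOnWith K (a i j) (closure (Ω : Set (E n))))
    (ha_ell : ∃ α > 0, ∀ x ∈ Ω, ∀ ξ : E n, α * ‖ξ‖ ^ 2 ≤ ∑ i, ∑ j, a i j x * ξ i * ξ j)
    -- the hypersurface
    (Γ : Set (E n)) (hΓ : IsC2Hypersurface Γ) (hΓΩ : Γ ⊆ (Ω : Set (E n)))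
    (hΓU : ∃ U : Set (E n), IsOpen U ∧ U ⊆ (Ω : Set (E n)) ∧ HasLipschitzBoundary U ∧
      Γ ⊆ frontier U)
    -- the data of the control problem
    (g : L2Surface Γ) (lo hi : EReal)
    (hbox : (∃ r s : ℝ, r < s ∧ lo = r ∧ hi = s) ∨ (lo = ⊥ ∧ hi = ⊤))
    (ν : ℝ) (hν : 0 < ν) :
    (∃! S : L2 Ω → H10 Ω, IsControlToState a a₀ S) ∧
    (∃! T : H10 Ω →L[ℝ] L2Surface Γ, IsTrace T) ∧
    ∀ (S : L2 Ω → H10 Ω) (T : H10 Ω →L[ℝ] L2Surface Γ), IsControlToState a a₀ S → IsTrace T →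
      ∃! u : L2 Ω, u ∈ admissible Ω lo hi ∧
        ∀ η ∈ admissible Ω lo hi, reducedCost S T g ν u ≤ reducedCost S T g ν η := by
  have hn0 : n ≠ 0 := by rcases hn with rfl | rfl <;> norm_num
  obtain ⟨S₀, ⟨K, hK⟩, hS₀, huniq⟩ := exists_controlToState hn0 hΩ
    (fun i j => memLp_top_of_lipschitz hΩ (ha_lip i j)) ha₀ ha₀_nonneg ha_ell
  refine ⟨⟨fun η => S₀ η, hS₀, huniq⟩, ?_, fun S T hS _ => ?_⟩
  · obtain ⟨U, -, hUΩ, hL, hΓU⟩ := hΓU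
    exact existsUnique_isTrace (hΩ.subset hUΩ) hL hΓU hΓΩ
  · obtain ⟨r, hlo, hhi⟩ : ∃ r : ℝ, lo ≤ r ∧ r ≤ hi := by
      rcases hbox with ⟨r, s, hrs, rfl, rfl⟩ | ⟨rfl, rfl⟩
      · exact ⟨r, le_rfl, EReal.coe_le_coe_iff.2 hrs.le⟩
      · exact ⟨0, bot_le, le_top⟩
    rw [huniq S hS]
    exact existsUnique_optimal_control hΩ S₀ hK T g hlo hhi hν
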